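/- Theorem (Improved Approximation of Pricing Mechanisms). A seller offers $m\ge 1$ products to one unit-demand buyer whose value profile $v=(v_1,\dots,v_m)\in\mathbb{R}^m_+$ is drawn from a known, arbitrarily correlated distribution $F$ with finite means (in particular, any finitely supported $F$). A mechanism $M=((S,\sigma),x,p)$ consists of a measurable signal space $S$, a Markov kernel $\sigma$ from value profiles to signals, a (measurable) allocation rule $x:S\to[0,1]^m$ with $\sum_i x_i\le 1$, and a (measurable) payment rule $p:S\to\mathbb{R}$. Let $\nu(s)$ be the posterior mean of $v$ given the signal $s$. The mechanism is IC if $\sum_i\nu_i(s)x_i(s)-p(s)\ge\sum_i\nu_i(s)x_i(s')-p(s')$ for almost every $s$ and all $s'\in S$, and IR if $\sum_i\nu_i(s)x_i(s)-p(s)\ge 0$ for almost every $s$. Its revenue is $\mathrm{Rev}(M)=\mathbb{E}[p(s)]$ and its welfare is $\mathrm{Wel}(M)=\mathbb{E}[\sum_i v_i x_i(s)]$; $\mathrm{OPT\text{-}Rev}$ and $\mathrm{OPT\text{-}Wel}$ are the suprema of these over all IC and IR mechanisms, with any signal space. $M$ is a pricing mechanism with prices $\hat p\in\mathbb{R}^m_+$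 if for every $s$ we have $x(s)\in\{0,1\}^m$ and $p(s)=\hat p\cdot x(s)$, and for almost every $s$ the set $x(s)$ maximizes $\max_i\nu_i(s)y_i-\hat p\cdot y$ over $y\in\{0,1\}^m$. It is a uniform pricing mechanism if all $\hat p_i$ are equal. Fix any measurable choice $i^*(v)\in\arg\max_i v_i$ (ties broken arbitrarily). $(S,\sigma)$ is a coarse horizontal disclosure if $S=2^{[m]}\setminus\{\emptyset\}$ and $\sigma(v)=\tau(i^*(v))$ for some $\tau:[m]\to\Delta(S)$ such that every set in the support of $\tau(i)$ contains $i$. Then: (1) For every $m\ge 1$, every such $F$ and every such $i^*$, there is an IC and IR pricing mechanism $M$ with a coarse horizontal disclosure, whose price vector takes at most two distinct values, such that $$\mathrm{Rev}(M)\ \ge\ 0.5017\cdot\mathrm{OPT\text{-}Rev}\qquad\text{and}\qquad \mathrm{Rev}(M)\ \ge\ 0.5017\cdot\mathrm{OPT\text{-}Wel}.$$ (2) This strictly beats what uniform pricing can guarantee: for every $c>1/2$ there is a finitely supported distribution $F$ on $\mathbb{R}^2_+$ such that every uniform pricing mechanism $M$, with any information structure, has $\mathrm{Rev}(M)<c\cdot\mathrm{OPT\text{-}Rev}$.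 -/

import Mathlib

open MeasureTheory ProbabilityTheory

universe u

/-- A selling mechanism for `m` products and one unit-demand buyer, whose value profile lives in
`Fin m → ℝ`. It consists of an information structure (the signal space `S` and the Markov kernel
`signal` from value profiles to signals), an allocation rule, which is a lottery over the products
(with the remaining probability nothing is sold), and a payment rule. -/
structure Mechanism (m : ℕ) (S : Type u) [MeasurableSpace S] where
  signal : Kernel (Fin m → ℝ) S
  isMarkovKernel_signal : IsMarkovKernel signal
  alloc : S → Fin m → ℝ
  pay : S → ℝ
  measurable_alloc : Measurable alloc
  measurable_pay : Measurable pay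
  alloc_nonneg : ∀ s i, 0 ≤ alloc s i
  alloc_sum_le_one : ∀ s, ∑ i, alloc s i ≤ 1

attribute [instance] Mechanism.isMarkovKernel_signal

/-- The utility of a unit-demand buyer with (posterior mean) values `ν` from a set of products with
indicator `x`, when paying `t`: he consumes the best product he receives. -/
noncomputable def unitDemandUtility {m : ℕ} (ν x : Fin m → ℝ) (t : ℝ) : ℝ :=
  (⨆ i, ν i * x i) - t

/-- The expected utility from a lottery `x` over the products, when paying `t`. -/
def lotteryUtility {m : ℕ} (ν x : Fin m → ℝ) (t : ℝ) : ℝ :=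
  (∑ i, ν i * x i) - t

namespace Mechanism

variable {m : ℕ} {S : Type u} [MeasurableSpace S]

/-- The ex-ante law of the signal when values are drawn from `F`. -/
noncomputable def signalLaw (M : Mechanism m S) (F : Measure (Fin m → ℝ)) : Measure S :=
  M.signal ∘ₘ F

/-- The mean of the values under the Bayesian posterior belief after signal `s`. As usual it is
determined up to a set of signals of probability zero. -/
noncomputable def posteriorMean (M : Mechanism m S) (F : Measure (Fin m → ℝ))
    [IsProbabilityMeasure F] (s : S) (i : Fin m) : ℝ :=
  ∫ v, v i ∂(posterior M.signal F s)

/-- Incentive compatibility: whatever signal was received (with probability one), reporting it is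
at least as good as reporting any other signal. -/
def IsIC (M : Mechanism m S) (F : Measure (Fin m → ℝ)) [IsProbabilityMeasure F] : Prop :=
  ∀ᵐ s ∂(M.signalLaw F), ∀ s' : S,
    lotteryUtility (M.posteriorMean F s) (M.alloc s') (M.pay s') ≤
      lotteryUtility (M.posteriorMean F s) (M.alloc s) (M.pay s)

/-- Interim individual rationality. -/
def IsIR (M : Mechanism m S) (F : Measure (Fin m → ℝ)) [IsProbabilityMeasure F] : Prop :=
  ∀ᵐ s ∂(M.signalLaw F),
    0 ≤ lotteryUtility (M.posteriorMean F s) (M.alloc s) (M.pay s)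

/-- Expected revenue. -/
noncomputable def rev (M : Mechanism m S) (F : Measure (Fin m → ℝ)) : ℝ :=
  ∫ s, M.pay s ∂(M.signalLaw F)

/-- Expected welfare, over the joint law of the values and the signal. -/
noncomputable def wel (M : Mechanism m S) (F : Measure (Fin m → ℝ)) : ℝ :=
  ∫ ω, ∑ i, ω.1 i * M.alloc ω.2 i ∂(F ⊗ₘ M.signal)

/-- `M` is implemented by posting the price `price i` for each product `i`: every outcome is a set
of products together with the sum of its prices, and after (almost) every signal the buyer gets
a set of products that he likes best at these prices. -/
def IsPricingWith (M : Mechanism m S) (F : Measure (Fin m → ℝ)) [IsProbabilityMeasure F]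
    (price : Fin m → ℝ) : Prop :=
  (∀ i, 0 ≤ price i) ∧
  (∀ s, (∀ i, M.alloc s i = 0 ∨ M.alloc s i = 1) ∧ M.pay s = ∑ i, price i * M.alloc s i) ∧
  ∀ᵐ s ∂(M.signalLaw F), ∀ y : Fin m → ℝ, (∀ i, y i = 0 ∨ y i = 1) →
    unitDemandUtility (M.posteriorMean F s) y (∑ i, price i * y i) ≤
      unitDemandUtility (M.posteriorMean F s) (M.alloc s) (∑ i, price i * M.alloc s i)

/-- A uniform pricing mechanism posts the same price for all products. -/
def IsUniformPricing (M : Mechanism m S) (F : Measure (Fin m → ℝ)) [IsProbabilityMeasure F] :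
    Prop :=
  ∃ p : ℝ, M.IsPricingWith F (fun _ => p)

end Mechanism

/-- The optimal revenue over all IC and IR mechanisms, with arbitrary signal spaces. The supremum is
taken in the extended reals. -/
noncomputable def optRev {m : ℕ} (F : Measure (Fin m → ℝ)) [IsProbabilityMeasure F] : EReal :=
  ⨆ (S : Type u) (_ : MeasurableSpace S) (M : Mechanism m S) (_ : M.IsIC F) (_ : M.IsIR F),
    (M.rev F : EReal)

/-- The optimal welfare over all IC and IR mechanisms, with arbitrary signal spaces. -/
noncomputable def optWel {m : ℕ} (F : Measure (Fin m → ℝ)) [IsProbabilityMeasure F] : EReal :=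
  ⨆ (S : Type u) (_ : MeasurableSpace S) (M : Mechanism m S) (_ : M.IsIC F) (_ : M.IsIR F),
    (M.wel F : EReal)

/-- The signal space of coarse horizontal disclosure: the nonempty sets of products. -/
def CoarseSignal (m : ℕ) : Type := {s : Finset (Fin m) // s.Nonempty}

instance (m : ℕ) : MeasurableSpace (CoarseSignal m) := ⊤

/-- Coarse horizontal disclosure: the distribution of the disclosed set of products depends only on
the favourite product `iStar v`, and the set always contains it. -/
def IsCoarseHorizontal {m : ℕ} (iStar : (Fin m → ℝ) → Fin m)
    (κ : Kernel (Fin m → ℝ) (CoarseSignal m)) : Prop :=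
  ∃ τ : Fin m → PMF (CoarseSignal m),
    (∀ v, κ v = (τ (iStar v)).toMeasure) ∧ ∀ i, ∀ s ∈ (τ i).support, i ∈ s.1

/-!
Both benchmarks are at most the mean value `W` of the favourite product (`Mechanism.wel_le`,
`Mechanism.rev_le`), so for the first half it suffices to earn `0.5017 * W`. Everything about the
distribution that matters is finite: the probabilities `q j` that `j` is the favourite product, and
the unnormalized means `A k j` of the value of `k` on the event that `j` is the favourite, which
satisfy `0 ≤ A k j ≤ A j j`. A coarse disclosure divides the buyers into pools with distinct labels,
and the posterior means in a pool are ratios of sums of the `A k j` and the `q j`. A `PoolingScheme`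
records these data together with what each pool pays, and `PoolingScheme.exists_mechanism` turns it
into a mechanism.

Normalize `W = 1`, write `p = 0.5017`, and let `H` be the set of products `j` with mean value
`A j j / q j` at least `p`.

* If `H` contributes at least `p` to the welfare, buyers outside `H` can be mixed into pools with
  favourite `j ∈ H` so that `j` has mean value at least `p` in each of them. Then everybody buys at
  the uniform price `p`.
* Otherwise almost all buyers lie outside `H` and have mean value close to `1 / 2`, while `H` has tiny
  mass, but contributes about `1 / 2` to the welfare. To raise the mean value of a product `i ∉ H` to
  `p`, very little welfare from `H` is needed if the buyers in `H` that are mixed in value `i` at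
  least about half as much as their favourite. A maximal transport plan
  (`exists_maximal_transport`) does this wherever possible. If it lifts a mass `0.0115` of buyers,
  the remaining contribution of `H` suffices to sell to all others as before, at the uniform price
  `p` (`PoolingScheme.exists_uniform`).
* If the transport plan gets stuck earlier, then up to a small exceptional set the buyers in `H` do
  not value the products outside `H` much. These products can be sold at the price `0.4`, while
  the buyers in `H`, diluted to mean value `4`, still prefer their favourite at the price `1.8`
  (`PoolingScheme.exists_twoPrice_of_exceptional`). This earns more than `p`.

For the second half, in `spikeMarket N` the first product is worth `N` with probability `1 / N`, and
otherwise the second product is worth `1`. Full disclosure with the prices `N` and `1` earns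
`2 - 1 / N`, while a uniform price earns at most `1`: up to the price `1` because of the price, and
beyond it because only the first product can be sold, whose mean value is `1`.
-/

/-! ### Posterior means and upper bounds for revenue and welfare -/

namespace Mechanism

variable {m : ℕ} {S : Type u} [MeasurableSpace S]

instance (M : Mechanism m S) (F : Measure (Fin m → ℝ)) [IsProbabilityMeasure F] :
    IsProbabilityMeasure (M.signalLaw F) := by
  unfold signalLaw; infer_instance

theorem integrable_value_mul (M : Mechanism m S) (F : Measure (Fin m → ℝ)) [IsProbabilityMeasure F]
    {i : Fin m} (hi : Integrable (fun v : Fin m → ℝ => v i) F)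
    {φ : S → ℝ} (hφ : Measurable φ) {C : ℝ} (hC : ∀ s, |φ s| ≤ C) :
    Integrable (fun ω : (Fin m → ℝ) × S => ω.1 i * φ ω.2) (F ⊗ₘ M.signal) := by
  have h1 : Integrable (fun ω : (Fin m → ℝ) × S => ω.1 i) (F ⊗ₘ M.signal) := by
    have := hi
    rw [← Measure.fst_compProd F M.signal, Measure.fst] at this
    exact this.comp_measurable measurable_fst
  exact h1.mul_bdd (c := C) (hφ.comp measurable_snd).aestronglyMeasurable
    (Filter.Eventually.of_forall fun ω => by simpa using hC ω.2)

theorem integrable_swap_value_mul (M : Mechanism m S) (F : Measure (Fin m → ℝ))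
    [IsProbabilityMeasure F]
    {i : Fin m} (hi : Integrable (fun v : Fin m → ℝ => v i) F)
    {φ : S → ℝ} (hφ : Measurable φ) {C : ℝ} (hC : ∀ s, |φ s| ≤ C) :
    Integrable (fun ω : S × (Fin m → ℝ) => ω.2 i * φ ω.1)
      (M.signalLaw F ⊗ₘ posterior M.signal F) := by
  rw [signalLaw, compProd_posterior_eq_map_swap]
  refine (integrable_map_equiv MeasurableEquiv.prodComm _).2 ?_
  exact M.integrable_value_mul F hi hφ hC

/-- The posterior mean, weighted by a bounded function of the signal, is integrable. -/
theorem integrable_posteriorMean_mul (M : Mechanism m S) (F : Measure (Fin m → ℝ))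
    [IsProbabilityMeasure F]
    {i : Fin m} (hi : Integrable (fun v : Fin m → ℝ => v i) F)
    {φ : S → ℝ} (hφ : Measurable φ) {C : ℝ} (hC : ∀ s, |φ s| ≤ C) :
    Integrable (fun s => M.posteriorMean F s i * φ s) (M.signalLaw F) := by
  have h := M.integrable_swap_value_mul F hi hφ hC
  rw [Measure.compProd] at h
  simpa [integral_mul_const, posteriorMean] using h.integral_compProd

/-- The tower property: in an expectation weighted by a function of the signal, a value may be
replaced by its posterior mean. -/
theorem integral_posteriorMean_mul (M : Mechanism m S) (F : Measure (Fin m → ℝ))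
    [IsProbabilityMeasure F]
    {i : Fin m} (hi : Integrable (fun v : Fin m → ℝ => v i) F)
    {φ : S → ℝ} (hφ : Measurable φ) {C : ℝ} (hC : ∀ s, |φ s| ≤ C) :
    ∫ s, M.posteriorMean F s i * φ s ∂(M.signalLaw F) =
      ∫ ω, ω.1 i * φ ω.2 ∂(F ⊗ₘ M.signal) := by
  have h := Measure.integral_compProd (M.integrable_swap_value_mul F hi hφ hC)
  simp only [integral_mul_const] at h
  unfold posteriorMean
  rw [← h, signalLaw, compProd_posterior_eq_map_swap]
  exact integral_map_equiv MeasurableEquiv.prodComm _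

/-- On a discrete signal space, Bayes' rule determines the posterior mean after every signal that
has positive probability. -/
theorem posteriorMean_mul_signalLaw [MeasurableSingletonClass S]
    (M : Mechanism m S) (F : Measure (Fin m → ℝ)) [IsProbabilityMeasure F]
    {i : Fin m} (hi : Integrable (fun v : Fin m → ℝ => v i) F) (s : S) :
    M.posteriorMean F s i * (M.signalLaw F).real {s} =
      ∫ v, v i * (M.signal v).real {s} ∂F := by
  have hφ : Measurable (Set.indicator {s} (fun _ : S => (1 : ℝ))) :=
    measurable_const.indicator (measurableSet_singleton s)
  have hC : ∀ t, |Set.indicator {s} (fun _ : S => (1 : ℝ)) t| ≤ 1 := fun t => by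
    by_cases h : t = s <;> simp [h]
  have h := M.integral_posteriorMean_mul F hi hφ hC
  rw [Measure.integral_compProd (M.integrable_value_mul F hi hφ hC)] at h
  have e1 : ∀ t, M.posteriorMean F t i * Set.indicator {s} (fun _ : S => (1 : ℝ)) t =
      Set.indicator {s} (fun _ => M.posteriorMean F s i) t := fun t => by
    by_cases h : t = s <;> simp [h]
  simp only [e1, integral_indicator (measurableSet_singleton s), setIntegral_const,
    integral_const_mul, smul_eq_mul, mul_one] at h
  rw [mul_comm]
  exact h

section bounds

variable (M : Mechanism m S) (F : Measure (Fin m → ℝ)) [IsProbabilityMeasure F]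

theorem alloc_le_one (s : S) (i : Fin m) : M.alloc s i ≤ 1 :=
  (Finset.single_le_sum (fun j _ => M.alloc_nonneg s j) (Finset.mem_univ i)).trans
    (M.alloc_sum_le_one s)

theorem abs_alloc_le_one (i : Fin m) (s : S) : |M.alloc s i| ≤ 1 := by
  rw [abs_of_nonneg (M.alloc_nonneg s i)]; exact M.alloc_le_one s i

theorem measurable_alloc_apply (i : Fin m) : Measurable fun s => M.alloc s i :=
  (measurable_pi_apply i).comp M.measurable_alloc

theorem integral_posteriorMean_alloc
    (hint : ∀ i, Integrable (fun v : Fin m → ℝ => v i) F) :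
    ∫ s, ∑ i, M.posteriorMean F s i * M.alloc s i ∂(M.signalLaw F) = M.wel F := by
  unfold wel
  rw [integral_finsetSum _ fun i _ => M.integrable_posteriorMean_mul F (hint i)
      (M.measurable_alloc_apply i) (M.abs_alloc_le_one i),
    integral_finsetSum _ fun i _ => M.integrable_value_mul F (hint i)
      (M.measurable_alloc_apply i) (M.abs_alloc_le_one i)]
  exact Finset.sum_congr rfl fun i _ => M.integral_posteriorMean_mul F (hint i)
      (M.measurable_alloc_apply i) (M.abs_alloc_le_one i)

omit [IsProbabilityMeasure F] in
theorem integrable_favourite (hint : ∀ i, Integrable (fun v : Fin m → ℝ => v i) F)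
    {iStar : (Fin m → ℝ) → Fin m} (hmeas : Measurable iStar) :
    Integrable (fun v : Fin m → ℝ => v (iStar v)) F := by
  have e : (fun v : Fin m → ℝ => v (iStar v)) =
      fun v => ∑ i, Set.indicator (iStar ⁻¹' {i}) (fun v => v i) v := by
    funext v
    rw [Finset.sum_eq_single (iStar v)]
    · simp
    · intro j _ hj
      simp [hj.symm]
    · simp
  rw [e]
  exact integrable_finsetSum _ fun i _ =>
    (hint i).indicator (hmeas (measurableSet_singleton i))

/-- The welfare of every mechanism is at most the mean value of the favourite product. -/
theorem wel_le (hnn : ∀ᵐ v ∂F, ∀ i, 0 ≤ v i)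
    (hint : ∀ i, Integrable (fun v : Fin m → ℝ => v i) F)
    {iStar : (Fin m → ℝ) → Fin m} (hmeas : Measurable iStar)
    (hmax : ∀ᵐ v ∂F, ∀ i, v i ≤ v (iStar v)) :
    M.wel F ≤ ∫ v, v (iStar v) ∂F := by
  have hfst : ∀ {p : (Fin m → ℝ) → Prop}, (∀ᵐ v ∂F, p v) → ∀ᵐ ω ∂(F ⊗ₘ M.signal), p ω.1 := by
    intro p hp
    rw [← Measure.fst_compProd F M.signal, Measure.fst] at hp
    exact ae_of_ae_map measurable_fst.aemeasurable hp
  have hW : Integrable (fun ω : (Fin m → ℝ) × S => ω.1 (iStar ω.1)) (F ⊗ₘ M.signal) := by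
    have := integrable_favourite F hint hmeas
    rw [← Measure.fst_compProd F M.signal, Measure.fst] at this
    exact this.comp_measurable measurable_fst
  have e : ∫ v, v (iStar v) ∂F = ∫ ω, ω.1 (iStar ω.1) ∂(F ⊗ₘ M.signal) := by
    rw [Measure.integral_compProd hW]
    simp
  rw [e]
  refine integral_mono_ae (integrable_finsetSum _ fun i _ => M.integrable_value_mul F (hint i)
      (M.measurable_alloc_apply i) (M.abs_alloc_le_one i)) hW ?_
  filter_upwards [hfst hnn, hfst hmax] with ω h0 h1
  calc ∑ i, ω.1 i * M.alloc ω.2 i ≤ ∑ i, ω.1 (iStar ω.1) * M.alloc ω.2 i :=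
        Finset.sum_le_sum fun i _ => mul_le_mul_of_nonneg_right (h1 i) (M.alloc_nonneg _ _)
    _ = ω.1 (iStar ω.1) * ∑ i, M.alloc ω.2 i := by rw [Finset.mul_sum]
    _ ≤ ω.1 (iStar ω.1) * 1 := mul_le_mul_of_nonneg_left (M.alloc_sum_le_one _) (h0 _)
    _ = _ := mul_one _

/-- By individual rationality the revenue is bounded by the welfare. -/
theorem rev_le (hnn : ∀ᵐ v ∂F, ∀ i, 0 ≤ v i)
    (hint : ∀ i, Integrable (fun v : Fin m → ℝ => v i) F)
    {iStar : (Fin m → ℝ) → Fin m} (hmeas : Measurable iStar)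
    (hmax : ∀ᵐ v ∂F, ∀ i, v i ≤ v (iStar v)) (hIR : M.IsIR F) :
    M.rev F ≤ ∫ v, v (iStar v) ∂F := by
  unfold rev
  by_cases hp : Integrable M.pay (M.signalLaw F)
  · refine le_trans ?_ (M.wel_le F hnn hint hmeas hmax)
    rw [← M.integral_posteriorMean_alloc F hint]
    refine integral_mono_ae hp (integrable_finsetSum _ fun i _ =>
      M.integrable_posteriorMean_mul F (hint i)
      (M.measurable_alloc_apply i) (M.abs_alloc_le_one i)) ?_
    filter_upwards [hIR] with s hs
    unfold lotteryUtility at hs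
    simpa using sub_nonneg.1 hs
  · -- a payment rule that is not integrable has revenue zero by convention
    rw [integral_undef hp]
    refine integral_nonneg_of_ae ?_
    filter_upwards [hnn] with v hv using hv _

end bounds

end Mechanism

theorem mul_optRev_le {m : ℕ} (F : Measure (Fin m → ℝ)) [IsProbabilityMeasure F]
    (hnn : ∀ᵐ v ∂F, ∀ i, 0 ≤ v i)
    (hint : ∀ i, Integrable (fun v : Fin m → ℝ => v i) F)
    {iStar : (Fin m → ℝ) → Fin m} (hmeas : Measurable iStar)
    (hmax : ∀ᵐ v ∂F, ∀ i, v i ≤ v (iStar v)) {c r : ℝ} (hc : 0 ≤ c)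
    (hr : c * ∫ v, v (iStar v) ∂F ≤ r) : (c : EReal) * optRev.{u} F ≤ (r : EReal) := by
  refine le_trans (mul_le_mul_of_nonneg_left
    (b := optRev.{u} F) (c := ((∫ v, v (iStar v) ∂F : ℝ) : EReal)) ?_ (by exact_mod_cast hc))
    (by exact_mod_cast hr)
  unfold optRev
  exact iSup_le fun S => iSup_le fun _ => iSup_le fun M => iSup_le fun _ => iSup_le fun hIR =>
    EReal.coe_le_coe_iff.2 (M.rev_le F hnn hint hmeas hmax hIR)

theorem mul_optWel_le {m : ℕ} (F : Measure (Fin m → ℝ)) [IsProbabilityMeasure F]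
    (hnn : ∀ᵐ v ∂F, ∀ i, 0 ≤ v i)
    (hint : ∀ i, Integrable (fun v : Fin m → ℝ => v i) F)
    {iStar : (Fin m → ℝ) → Fin m} (hmeas : Measurable iStar)
    (hmax : ∀ᵐ v ∂F, ∀ i, v i ≤ v (iStar v)) {c r : ℝ} (hc : 0 ≤ c)
    (hr : c * ∫ v, v (iStar v) ∂F ≤ r) : (c : EReal) * optWel.{u} F ≤ (r : EReal) := by
  refine le_trans (mul_le_mul_of_nonneg_left
    (b := optWel.{u} F) (c := ((∫ v, v (iStar v) ∂F : ℝ) : EReal)) ?_ (by exact_mod_cast hc))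
    (by exact_mod_cast hr)
  unfold optWel
  exact iSup_le fun S => iSup_le fun _ => iSup_le fun M => iSup_le fun _ => iSup_le fun _ =>
    EReal.coe_le_coe_iff.2 (M.wel_le F hnn hint hmeas hmax)

/-! ### Best purchases -/

section bestResponse

variable {m : ℕ}

/-- The indicator vector of a purchase of at most one product. -/
def purchase (o : Option (Fin m)) (i : Fin m) : ℝ := if o = some i then 1 else 0

/-- The amount paid for a purchase of at most one product. -/
def purchasePrice (price : Fin m → ℝ) (o : Option (Fin m)) : ℝ := o.elim 0 price

/-- The utility of a purchase of at most one product. -/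
def purchaseUtility (ν price : Fin m → ℝ) (o : Option (Fin m)) : ℝ :=
  o.elim 0 fun i => ν i - price i

/-- A utility maximizing purchase that, among the maximizers, has the highest price. -/
def IsBestPurchase (ν price : Fin m → ℝ) (o : Option (Fin m)) : Prop :=
  (∀ o', purchaseUtility ν price o' ≤ purchaseUtility ν price o) ∧
    ∀ o', purchaseUtility ν price o' = purchaseUtility ν price o →
      purchasePrice price o' ≤ purchasePrice price o

theorem exists_isBestPurchase (ν price : Fin m → ℝ) : ∃ o, IsBestPurchase ν price o := by
  obtain ⟨o₁, -, h₁⟩ := Finset.exists_max_image Finset.univ (purchaseUtility ν price)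
    ⟨none, Finset.mem_univ _⟩
  obtain ⟨o₂, h₂, h₃⟩ := Finset.exists_max_image
    (Finset.univ.filter fun o => purchaseUtility ν price o = purchaseUtility ν price o₁)
    (purchasePrice price) ⟨o₁, by simp⟩
  simp only [Finset.mem_filter, Finset.mem_univ, true_and] at h₂ h₃ h₁
  exact ⟨o₂, fun o' => h₂ ▸ h₁ o' trivial, fun o' ho' => h₃ o' (ho'.trans h₂)⟩

/-- If some affordable product of price at least `r` is as good as every product cheaper than `r`,
then a best purchase pays at least `r`. -/
theorem IsBestPurchase.le_purchasePrice {ν price : Fin m → ℝ} {o : Option (Fin m)}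
    (h : IsBestPurchase ν price o) {r : ℝ} {i : Fin m} (hi : r ≤ price i) (h0 : price i ≤ ν i)
    (hl : ∀ l, price l < r → ν l - price l ≤ ν i - price i) : r ≤ purchasePrice price o := by
  have key : purchaseUtility ν price o ≤ purchaseUtility ν price (some i) →
      r ≤ purchasePrice price o := fun hle =>
    hi.trans (h.2 (some i) (le_antisymm (h.1 _) hle))
  cases o with
  | none => exact key (sub_nonneg.2 h0)
  | some l =>
    by_contra hlt
    exact hlt (key (hl l (not_le.1 hlt)))

theorem sum_purchase (f : Fin m → ℝ) (o : Option (Fin m)) :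
    ∑ i, f i * purchase o i = o.elim 0 f := by
  cases o with
  | none => simp [purchase]
  | some j => simp [purchase]

theorem lotteryUtility_purchase (ν price : Fin m → ℝ) (o : Option (Fin m)) :
    lotteryUtility ν (purchase o) (purchasePrice price o) = purchaseUtility ν price o := by
  rw [lotteryUtility, sum_purchase]
  cases o <;> simp [purchasePrice, purchaseUtility]

theorem purchaseUtility_le_unitDemandUtility (ν price : Fin m → ℝ) (o : Option (Fin m)) :
    purchaseUtility ν price o ≤
      unitDemandUtility ν (purchase o) (∑ i, price i * purchase o i) := by
  rw [unitDemandUtility, sum_purchase]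
  cases o with
  | none => simp [purchaseUtility, purchase]
  | some j =>
    have := le_ciSup (Set.finite_range fun i => ν i * purchase (some j) i).bddAbove j
    simp only [purchase, if_true, mul_one] at this
    simpa [purchaseUtility, purchase] using this

/-- A unit-demand buyer gains nothing from buying several products at nonnegative prices. -/
theorem unitDemandUtility_le_of_isBestPurchase [Nonempty (Fin m)] {ν price : Fin m → ℝ}
    (hp : ∀ i, 0 ≤ price i) {o : Option (Fin m)} (h : IsBestPurchase ν price o) (y : Fin m → ℝ)
    (hy : ∀ i, y i = 0 ∨ y i = 1) :
    unitDemandUtility ν y (∑ i, price i * y i) ≤ purchaseUtility ν price o := by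
  unfold unitDemandUtility
  obtain ⟨i, hi⟩ := exists_eq_ciSup_of_finite (f := fun i => ν i * y i)
  have hy0 : ∀ i, 0 ≤ y i := fun i => by rcases hy i with h | h <;> rw [h]; norm_num
  rw [← hi]
  rcases hy i with h0 | h1
  · refine le_trans ?_ (h.1 none)
    rw [h0, mul_zero, zero_sub, neg_le]
    simpa [purchaseUtility] using Finset.sum_nonneg fun i _ => mul_nonneg (hp i) (hy0 i)
  · refine le_trans ?_ (h.1 (some i))
    have := Finset.single_le_sum (fun j _ => mul_nonneg (hp j) (hy0 j)) (Finset.mem_univ i)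
    rw [h1, mul_one] at this
    simp only [purchaseUtility, h1, mul_one, Option.elim_some]
    linarith

end bestResponse

/-! ### Pooling schemes -/

/-- A finite description of a pricing mechanism with coarse horizontal disclosure, for a market in
which product `j` is the favourite with probability `q j` and `A k j` is the expectation of the
value of product `k` on the event that product `j` is the favourite. The buyers are divided into
pools indexed by products: `share j k` is the share of the buyers with favourite `j` that is put
into pool `k`, and the members of pool `k` learn the set `label k`. The number `rate k` is a lower
bound for what every member of pool `k` pays. -/
structure PoolingScheme {m : ℕ} (q : Fin m → ℝ) (A : Fin m → Fin m → ℝ) where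
  share : Fin m → Fin m → ℝ
  label : Fin m → Finset (Fin m)
  price : Fin m → ℝ
  rate : Fin m → ℝ
  share_nonneg : ∀ j k, 0 ≤ share j k
  sum_share : ∀ j, ∑ k, share j k = 1
  label_injective : Function.Injective label
  mem_label_self : ∀ k, k ∈ label k
  mem_label : ∀ j k, share j k ≠ 0 → j ∈ label k
  price_nonneg : ∀ i, 0 ≤ price i
  ncard_price : (Set.range price).ncard ≤ 2
  /-- After the signal `label k` some product of price at least `rate k` is affordable and at least
  as good as every cheaper product; both sides are multiplied by the mass of the pool. -/
  sells : ∀ k, rate k = 0 ∨ ∃ i, rate k ≤ price i ∧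
    price i * (∑ j, q j * share j k) ≤ ∑ j, A i j * share j k ∧
    ∀ l, price l < rate k →
      (∑ j, A l j * share j k) - price l * (∑ j, q j * share j k) ≤
        (∑ j, A i j * share j k) - price i * (∑ j, q j * share j k)

namespace PoolingScheme

variable {m : ℕ} {q : Fin m → ℝ} {A : Fin m → Fin m → ℝ}

/-- The lower bound for the revenue that a pooling scheme certifies. -/
def revenue (P : PoolingScheme q A) : ℝ := ∑ k, P.rate k * ∑ j, q j * P.share j k

instance : Fintype (CoarseSignal m) := by unfold CoarseSignal; infer_instance

instance : MeasurableSingletonClass (CoarseSignal m) := ⟨fun _ => trivial⟩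

/-- The label of a pool as a signal. -/
def signalOf (P : PoolingScheme q A) (k : Fin m) : CoarseSignal m :=
  ⟨P.label k, ⟨k, P.mem_label_self k⟩⟩

theorem signalOf_injective (P : PoolingScheme q A) : Function.Injective P.signalOf :=
  fun _ _ h => P.label_injective (congrArg Subtype.val h)

/-- The random signal sent to buyers with favourite product `j`. -/
noncomputable def lottery (P : PoolingScheme q A) (j : Fin m) : PMF (CoarseSignal m) :=
  (PMF.ofFintype (fun k => ENNReal.ofReal (P.share j k)) (by
    rw [← ENNReal.ofReal_sum_of_nonneg fun k _ => P.share_nonneg j k, P.sum_share,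
      ENNReal.ofReal_one])).map P.signalOf

theorem lottery_signalOf (P : PoolingScheme q A) (j k : Fin m) :
    P.lottery j (P.signalOf k) = ENNReal.ofReal (P.share j k) := by
  rw [lottery, PMF.map_apply, tsum_eq_single k]
  · simp
  · intro l hl
    rw [if_neg fun h => hl (P.signalOf_injective h).symm]

theorem mem_of_mem_support_lottery (P : PoolingScheme q A) (j : Fin m) (s : CoarseSignal m)
    (hs : s ∈ (P.lottery j).support) : j ∈ s.1 := by
  rw [lottery, PMF.mem_support_map_iff] at hs
  obtain ⟨k, hk, rfl⟩ := hs
  refine P.mem_label j k fun h => ?_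
  simp [h] at hk

/-- Multiplies all values, and with them all prices, by a positive factor. -/
def scale {A' : Fin m → Fin m → ℝ} (P : PoolingScheme q A) {w : ℝ} (hw : 0 < w)
    (hA : ∀ i j, A' i j = w * A i j) : PoolingScheme q A' where
  share := P.share
  label := P.label
  price i := w * P.price i
  rate k := w * P.rate k
  share_nonneg := P.share_nonneg
  sum_share := P.sum_share
  label_injective := P.label_injective
  mem_label_self := P.mem_label_self
  mem_label := P.mem_label
  price_nonneg i := mul_nonneg hw.le (P.price_nonneg i)
  ncard_price := by
    have : Set.range (fun i => w * P.price i) = (fun t => w * t) '' Set.range P.price := by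
      rw [← Set.range_comp]; rfl
    rw [this]
    exact (Set.ncard_image_le (Set.finite_range _)).trans P.ncard_price
  sells k := by
    have e : ∀ i, ∑ j, A' i j * P.share j k = w * ∑ j, A i j * P.share j k := fun i => by
      simp only [hA, mul_assoc, Finset.mul_sum]
    simp only [e, mul_assoc, ← mul_sub]
    rcases P.sells k with h | ⟨i, h1, h2, h3⟩
    · exact Or.inl (by rw [h, mul_zero])
    · exact Or.inr ⟨i, mul_le_mul_of_nonneg_left h1 hw.le, mul_le_mul_of_nonneg_left h2 hw.le,
        fun l hl => mul_le_mul_of_nonneg_left (h3 l (lt_of_mul_lt_mul_left hl hw.le)) hw.le⟩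

theorem revenue_scale {A' : Fin m → Fin m → ℝ} (P : PoolingScheme q A) {w : ℝ} (hw : 0 < w)
    (hA : ∀ i j, A' i j = w * A i j) : (P.scale hw hA).revenue = w * P.revenue := by
  simp only [revenue, scale, Finset.mul_sum, mul_assoc]

end PoolingScheme

/-- An integral against a function of the favourite product splits over the favourites. -/
theorem integral_mul_comp_favourite {m : ℕ} {F : Measure (Fin m → ℝ)}
    {iStar : (Fin m → ℝ) → Fin m} (hmeas : Measurable iStar)
    {f : (Fin m → ℝ) → ℝ} (hf : Integrable f F) (G : Fin m → ℝ) :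
    ∫ v, f v * G (iStar v) ∂F = ∑ j, (∫ v in iStar ⁻¹' {j}, f v ∂F) * G j := by
  have hm : ∀ j, MeasurableSet (iStar ⁻¹' {j}) := fun j => hmeas (measurableSet_singleton j)
  have e : (fun v => f v * G (iStar v)) =
      fun v => ∑ j, Set.indicator (iStar ⁻¹' {j}) f v * G j := by
    funext v
    rw [Finset.sum_eq_single (iStar v)]
    · simp
    · intro j _ hj
      simp [hj.symm]
    · simp
  rw [e, integral_finsetSum _ fun j _ => (hf.indicator (hm j)).mul_const _]
  refine Finset.sum_congr rfl fun j _ => ?_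
  rw [integral_mul_const, integral_indicator (hm j)]

/-- A pooling scheme is implemented by a pricing mechanism with coarse horizontal disclosure. -/
theorem PoolingScheme.exists_mechanism {m : ℕ} (F : Measure (Fin m → ℝ)) [IsProbabilityMeasure F]
    (hint : ∀ i, Integrable (fun v : Fin m → ℝ => v i) F)
    {iStar : (Fin m → ℝ) → Fin m} (hmeas : Measurable iStar)
    (P : PoolingScheme (fun j => F.real (iStar ⁻¹' {j}))
      (fun i j => ∫ v in iStar ⁻¹' {j}, v i ∂F)) :
    ∃ (M : Mechanism m (CoarseSignal m)) (price : Fin m → ℝ),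
      IsCoarseHorizontal iStar M.signal ∧ M.IsPricingWith F price ∧
      (Set.range price).ncard ≤ 2 ∧ M.IsIC F ∧ M.IsIR F ∧ P.revenue ≤ M.rev F := by
  have : Nonempty (Fin m) := ⟨iStar 0⟩
  let κ : Kernel (Fin m → ℝ) (CoarseSignal m) :=
    (Kernel.ofFunOfCountable fun j => (P.lottery j).toMeasure).comap iStar hmeas
  have hκ : ∀ v, κ v = (P.lottery (iStar v)).toMeasure := fun v => rfl
  have : IsMarkovKernel κ := ⟨fun v => by rw [hκ]; infer_instance⟩
  let ν : CoarseSignal m → Fin m → ℝ := fun s i => ∫ v, v i ∂(posterior κ F s)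
  -- ties are broken in favour of the higher price, and the same rule is used off the support
  choose o ho using fun s => exists_isBestPurchase (ν s) P.price
  let M : Mechanism m (CoarseSignal m) :=
    { signal := κ
      isMarkovKernel_signal := inferInstance
      alloc := fun s => purchase (o s)
      pay := fun s => purchasePrice P.price (o s)
      measurable_alloc := fun _ _ => trivial
      measurable_pay := fun _ _ => trivial
      alloc_nonneg := fun s i => by simp only [purchase]; split_ifs <;> norm_num
      alloc_sum_le_one := fun s => by
        have := sum_purchase (fun _ => 1) (o s)
        simp only [one_mul] at this
        rw [this]
        cases o s <;> simp }
  have hν : ∀ s i, M.posteriorMean F s i = ν s i := fun _ _ => rfl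
  have hpay0 : ∀ s, 0 ≤ M.pay s := fun s => by
    change 0 ≤ purchasePrice P.price (o s)
    cases o s with
    | none => exact le_rfl
    | some i => exact P.price_nonneg i
  refine ⟨M, P.price, ⟨P.lottery, hκ, P.mem_of_mem_support_lottery⟩,
    ⟨P.price_nonneg, fun s => ⟨fun i => ?_, ?_⟩, ?_⟩, P.ncard_price, ?_, ?_, ?_⟩
  · change purchase (o s) i = 0 ∨ purchase (o s) i = 1
    simp only [purchase]; split_ifs <;> simp
  · exact (sum_purchase P.price (o s)).symm
  · exact Filter.Eventually.of_forall fun s y hy =>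
      (unitDemandUtility_le_of_isBestPurchase P.price_nonneg (ho s) y hy).trans
        (purchaseUtility_le_unitDemandUtility _ _ _)
  · refine Filter.Eventually.of_forall fun s s' => ?_
    change lotteryUtility (ν s) (purchase (o s')) (purchasePrice P.price (o s')) ≤
      lotteryUtility (ν s) (purchase (o s)) (purchasePrice P.price (o s))
    rw [lotteryUtility_purchase, lotteryUtility_purchase]
    exact (ho s).1 _
  · refine Filter.Eventually.of_forall fun s => ?_
    change 0 ≤ lotteryUtility (ν s) (purchase (o s)) (purchasePrice P.price (o s))
    rw [lotteryUtility_purchase]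
    exact (ho s).1 none
  · have hκr : ∀ v k, (κ v).real {P.signalOf k} = P.share (iStar v) k := fun v k => by
      rw [measureReal_def, hκ, PMF.toMeasure_apply_singleton _ _ (measurableSet_singleton _),
        P.lottery_signalOf, ENNReal.toReal_ofReal (P.share_nonneg _ _)]
    have hmass : ∀ k, (M.signalLaw F).real {P.signalOf k} =
        ∑ j, F.real (iStar ⁻¹' {j}) * P.share j k := fun k => by
      have h1 : (M.signalLaw F).real {P.signalOf k} = ∫ v, (κ v).real {P.signalOf k} ∂F := by
        rw [Mechanism.signalLaw, measureReal_def, Measure.bind_apply (measurableSet_singleton _)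
          κ.aemeasurable]
        refine (integral_toReal (κ.measurable_coe (measurableSet_singleton _)).aemeasurable
          (Filter.Eventually.of_forall fun v => measure_lt_top _ _)).symm
      rw [h1]
      have h2 := integral_mul_comp_favourite hmeas (integrable_const (1 : ℝ) (μ := F))
        (fun j => P.share j k)
      simp only [one_mul, setIntegral_const, smul_eq_mul, mul_one] at h2
      simp only [hκr]
      exact h2
    have hnum : ∀ k i, ν (P.signalOf k) i * (M.signalLaw F).real {P.signalOf k} =
        ∑ j, (∫ v in iStar ⁻¹' {j}, v i ∂F) * P.share j k := fun k i => by
      have := M.posteriorMean_mul_signalLaw F (hint i) (P.signalOf k)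
      rw [hν] at this
      rw [this, ← integral_mul_comp_favourite hmeas (hint i)]
      exact integral_congr_ae (Filter.Eventually.of_forall fun v => by
        change v i * (κ v).real _ = _
        rw [hκr])
    have hrev : M.rev F = ∑ s, (M.signalLaw F).real {s} * M.pay s := by
      rw [Mechanism.rev, integral_fintype .of_finite]
      rfl
    have hle : ∀ k, P.rate k * ∑ j, F.real (iStar ⁻¹' {j}) * P.share j k ≤
        (M.signalLaw F).real {P.signalOf k} * M.pay (P.signalOf k) := fun k => by
      rw [← hmass, mul_comm]
      rcases (measureReal_nonneg (μ := M.signalLaw F) (s := {P.signalOf k})).eq_or_lt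
        with h0 | hpos
      · rw [← h0, zero_mul, zero_mul]
      refine mul_le_mul_of_nonneg_left ?_ hpos.le
      rcases P.sells k with h0 | ⟨i, h1, h2, h3⟩
      · rw [h0]; exact hpay0 _
      · rw [← hmass, ← hnum] at h2
        refine (ho (P.signalOf k)).le_purchasePrice h1 (le_of_mul_le_mul_right h2 hpos)
          fun l hl => ?_
        have := h3 l hl
        rw [← hmass, ← hnum, ← hnum, ← sub_mul, ← sub_mul] at this
        exact le_of_mul_le_mul_right this hpos
    rw [hrev]
    calc P.revenue ≤ ∑ k, (M.signalLaw F).real {P.signalOf k} * M.pay (P.signalOf k) :=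
          Finset.sum_le_sum fun k _ => hle k
      _ = ∑ s ∈ Finset.univ.map ⟨P.signalOf, P.signalOf_injective⟩,
            (M.signalLaw F).real {s} * M.pay s := by simp
      _ ≤ _ := Finset.sum_le_univ_sum_of_nonneg fun s =>
          mul_nonneg measureReal_nonneg (hpay0 s)

/-! ### Transport plans and weights -/

/-- A maximal transport plan along admissible pairs: `i` has a capacity for the weighted load it
receives, every `j` has one unit to give away, and no admissible pair has slack on both sides. -/
theorem exists_maximal_transport {α β : Type*} [Fintype α] [Fintype β]
    (good : α → β → Prop) (b : α → β → ℝ) (hb : ∀ i j, good i j → 0 ≤ b i j)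
    (cap : α → ℝ) (hcap : ∀ i, 0 ≤ cap i) :
    ∃ f : α → β → ℝ, (∀ i j, 0 ≤ f i j) ∧ (∀ i j, ¬ good i j → f i j = 0) ∧
      (∀ j, ∑ i, f i j ≤ 1) ∧ (∀ i, ∑ j, f i j * b i j ≤ cap i) ∧
      ∀ i j, good i j → ∑ j, f i j * b i j = cap i ∨ ∑ i, f i j = 1 := by
  classical
  let K : Set (α → β → ℝ) := {f | (∀ i j, 0 ≤ f i j) ∧ (∀ i j, ¬ good i j → f i j = 0) ∧
      (∀ j, ∑ i, f i j ≤ 1) ∧ (∀ i, ∑ j, f i j * b i j ≤ cap i)}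
  have hclosed : IsClosed K := by
    simp only [K, Set.ofPred_and, Set.ofPred_forall]
    refine .inter ?_ (.inter ?_ (.inter ?_ ?_))
    · exact isClosed_iInter fun i => isClosed_iInter fun j =>
        isClosed_le continuous_const (by fun_prop)
    · exact isClosed_iInter fun i => isClosed_iInter fun j => isClosed_iInter fun _ =>
        isClosed_eq (by fun_prop) continuous_const
    · exact isClosed_iInter fun j => isClosed_le (by fun_prop) continuous_const
    · exact isClosed_iInter fun i => isClosed_le (by fun_prop) continuous_const
  have hcompact : IsCompact K :=
    (isCompact_Icc (a := (0 : α → β → ℝ)) (b := 1)).of_isClosed_subset hclosed fun f hf =>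
      ⟨fun i j => hf.1 i j, fun i j =>
        (Finset.single_le_sum (fun k _ => hf.1 k j) (Finset.mem_univ i)).trans (hf.2.2.1 j)⟩
  obtain ⟨f, ⟨h0, hsupp, hrow, hload⟩, hmax⟩ := hcompact.exists_isMaxOn
    ⟨0, by simp [K, hcap]⟩
    (f := fun f : α → β → ℝ => ∑ i, ∑ j, f i j) (by fun_prop)
  refine ⟨f, h0, hsupp, hrow, hload, fun i j hij => ?_⟩
  by_contra hcon
  push Not at hcon
  have h1 : 0 < 1 - ∑ i, f i j := sub_pos.2 (lt_of_le_of_ne (hrow j) hcon.2)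
  have h2 : 0 < cap i - ∑ j, f i j * b i j := sub_pos.2 (lt_of_le_of_ne (hload i) hcon.1)
  have hb1 : 0 < b i j + 1 := by linarith [hb i j hij]
  -- a slack pair could carry an additional amount `δ`
  obtain ⟨δ, hδ, hδ1, hδ2⟩ : ∃ δ : ℝ, 0 < δ ∧ δ ≤ 1 - ∑ i, f i j ∧
      δ * b i j ≤ cap i - ∑ j, f i j * b i j := by
    refine ⟨min (1 - ∑ i, f i j) ((cap i - ∑ j, f i j * b i j) / (b i j + 1)),
      lt_min h1 (div_pos h2 hb1), min_le_left _ _, ?_⟩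
    refine (mul_le_mul_of_nonneg_right (min_le_right _ _) (hb i j hij)).trans ?_
    rw [div_mul_eq_mul_div, div_le_iff₀ hb1]
    nlinarith [hb i j hij]
  have hg : (fun k l => f k l + if k = i ∧ l = j then δ else 0) ∈ K := by
    refine ⟨fun k l => ?_, fun k l hkl => ?_, fun l => ?_, fun k => ?_⟩
    · exact add_nonneg (h0 k l) (by split_ifs <;> linarith)
    · have : ¬ (k = i ∧ l = j) := by rintro ⟨rfl, rfl⟩; exact hkl hij
      simp [this, hsupp k l hkl]
    · rw [Finset.sum_add_distrib]
      by_cases hl : l = j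
      · subst hl; simp; linarith
      · simpa [hl] using hrow l
    · simp only [add_mul, Finset.sum_add_distrib, ite_mul, zero_mul]
      by_cases hk : k = i
      · subst hk; simp; linarith
      · simpa [hk] using hload k
  have := hmax hg
  simp only [Set.mem_ofPred_eq, Finset.sum_add_distrib] at this
  simp only [ite_and, Finset.sum_ite_irrel, Finset.sum_ite_eq', Finset.mem_univ, if_true,
    Finset.sum_const_zero] at this
  linarith

/-- Weights on a nonempty finite set that are proportional to given nonnegative capacities, in the
form that covers capacities summing to zero. -/
theorem exists_proportional_weights {α : Type*} [DecidableEq α] {H : Finset α} (hH : H.Nonempty)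
    {t : α → ℝ} (ht : ∀ j ∈ H, 0 ≤ t j) {R : ℝ} (hR : R ≤ ∑ j ∈ H, t j) :
    ∃ s : α → ℝ, (∀ j, 0 ≤ s j) ∧ (∀ j, j ∉ H → s j = 0) ∧ ∑ j ∈ H, s j = 1 ∧
      ∀ j ∈ H, s j * R ≤ t j := by
  rcases (Finset.sum_nonneg ht).eq_or_lt with h0 | hpos
  · obtain ⟨j₀, hj₀⟩ := hH
    refine ⟨fun j => if j = j₀ then 1 else 0, fun j => ?_, fun j hj => ?_, by simp [hj₀],
      fun j hj => ?_⟩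
    · dsimp only; split_ifs <;> norm_num
    · exact if_neg fun h => hj (by rwa [h])
    · have := ht j hj
      dsimp only; split_ifs <;> linarith
  · refine ⟨fun j => if j ∈ H then t j / ∑ j ∈ H, t j else 0, fun j => ?_, fun j hj => if_neg hj,
      ?_, fun j hj => ?_⟩
    · dsimp only
      split_ifs with h
      · exact div_nonneg (ht j h) hpos.le
      · exact le_rfl
    · rw [Finset.sum_congr rfl fun j hj => if_pos hj, ← Finset.sum_div, div_self hpos.ne']
    · dsimp only
      rw [if_pos hj, div_mul_eq_mul_div, div_le_iff₀ hpos]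
      exact mul_le_mul_of_nonneg_left hR (ht j hj)

theorem ncard_range_le_two_of_forall {α : Type*} {f : α → ℝ} {a b : ℝ}
    (h : ∀ i, f i = a ∨ f i = b) :
    (Set.range f).ncard ≤ 2 :=
  (Set.ncard_le_ncard (t := {a, b}) (by rintro _ ⟨i, rfl⟩; simpa using h i)).trans
    ((Set.ncard_insert_le a {b}).trans (by simp))

/-! ### Uniform-price and two-price schemes -/

namespace PoolingScheme

variable {m : ℕ} {q : Fin m → ℝ} {A : Fin m → Fin m → ℝ}

/-- Everybody buys at the uniform price `p`. The buyers with favourite `i ∉ H` are divided into a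
share `x i` that is sold product `i`, because a share `f i j` of the buyers with favourite `j ∈ H`
is mixed in, and a remainder that is mixed with the remaining buyers whose favourite `j` lies in `H`
and is sold `j`. -/
theorem exists_uniform {p : ℝ} (hp : 0 ≤ p)
    (hq1 : ∑ j, q j = 1) (hA : ∀ i j, 0 ≤ A i j)
    {H : Finset (Fin m)} (hH : H.Nonempty) (hd : ∀ j ∈ H, p * q j ≤ A j j)
    {f : Fin m → Fin m → ℝ} (hf : ∀ i j, 0 ≤ f i j) (hf0 : ∀ i j, ¬ (i ∉ H ∧ j ∈ H) → f i j = 0)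
    (hf1 : ∀ j, ∑ i, f i j ≤ 1)
    {x : Fin m → ℝ} (hx : ∀ i, 0 ≤ x i) (hx1 : ∀ i, x i ≤ 1)
    (hload : ∀ i, i ∉ H → x i * (p * q i - A i i) ≤ ∑ j, f i j * (A i j - p * q j))
    (hrest : p * ∑ i ∈ Hᶜ, q i * (1 - x i) ≤
      ∑ j ∈ H, (1 - ∑ i, f i j) * (A j j - p * q j))
    {label : Fin m → Finset (Fin m)} (hinj : Function.Injective label)
    (hself : ∀ k, k ∈ label k) (hlf : ∀ i j, f i j ≠ 0 → j ∈ label i)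
    (hlx : ∀ i j, i ∉ H → j ∈ H → x i ≠ 1 → i ∈ label j) :
    ∃ P : PoolingScheme q A, p ≤ P.revenue := by
  obtain ⟨s, hs0, hsH, hs1, hsR⟩ := exists_proportional_weights hH
    (fun j hj => mul_nonneg (sub_nonneg.2 (hf1 j)) (sub_nonneg.2 (hd j hj))) hrest
  let share : Fin m → Fin m → ℝ := fun t k =>
    if t ∈ H then f k t + (if k = t then 1 - ∑ i, f i t else 0)
    else (if k = t then x t else 0) + (1 - x t) * s k
  have hs1' : ∑ k, s k = 1 := by
    rw [← hs1]; exact (Finset.sum_subset (Finset.subset_univ H) fun j _ hj => hsH j hj).symm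
  have hsum : ∀ j, ∑ k, share j k = 1 := fun j => by
    by_cases hj : j ∈ H
    · simp [share, hj, Finset.sum_add_distrib]
    · simp [share, hj, Finset.sum_add_distrib, ← Finset.mul_sum, hs1']
  have hlow : ∀ (a : Fin m → ℝ) k, k ∉ H →
      ∑ t, a t * share t k = a k * x k + ∑ t, f k t * a t := fun a k hk => by
    have e : ∀ t, a t * share t k = (if k = t then a t * x t else 0) + f k t * a t := fun t => by
      by_cases ht : t ∈ H
      · have hkt : k ≠ t := fun h => hk (h ▸ ht)
        simp [share, ht, hkt]; ring
      · simp [share, ht, hsH k hk, hf0 k t (fun h => ht h.2)]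
    simp [e, Finset.sum_add_distrib]
  have hhigh : ∀ (a : Fin m → ℝ) k, k ∈ H →
      ∑ t, a t * share t k = a k * (1 - ∑ i, f i k) + s k * ∑ t ∈ Hᶜ, a t * (1 - x t) :=
    fun a k hk => by
    rw [← Finset.sum_add_sum_compl H, Finset.mul_sum]
    congr 1
    · rw [Finset.sum_eq_single_of_mem k hk]
      · simp [share, hk, hf0 k k (fun h => h.1 hk)]
      · intro t ht htk
        simp [share, ht, hf0 k t (fun h => h.1 hk), htk.symm]
    · refine Finset.sum_congr rfl fun t ht => ?_
      have ht' : t ∉ H := Finset.mem_compl.1 ht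
      have hkt : k ≠ t := fun h => ht' (h ▸ hk)
      simp [share, ht', hkt]; ring
  refine ⟨{ share := share
            label := label
            price := fun _ => p
            rate := fun _ => p
            share_nonneg := fun j k => ?_
            sum_share := hsum
            label_injective := hinj
            mem_label_self := hself
            mem_label := fun j k hjk => ?_
            price_nonneg := fun _ => hp
            ncard_price := ncard_range_le_two_of_forall (b := p) fun _ => Or.inl rfl
            sells := fun k => Or.inr ⟨k, le_rfl, ?_, fun l hl => absurd hl (lt_irrefl _)⟩ }, ?_⟩
  · simp only [share]
    have h1 := hf1 j
    have h2 := hx1 j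
    have h3 := hx j
    have h4 := hf k j
    have h5 := mul_nonneg (sub_nonneg.2 h2) (hs0 k)
    split_ifs <;> linarith
  · by_cases hkj : k = j
    · exact hkj ▸ hself k
    by_cases hj : j ∈ H
    · exact hlf k j (by simpa [share, hj, hkj] using hjk)
    · have h1 : 1 - x j ≠ 0 ∧ s k ≠ 0 := by simpa [share, hj, hkj] using hjk
      refine hlx j k hj ?_ fun h => h1.1 (by rw [h, sub_self])
      by_contra hk
      exact h1.2 (hsH k hk)
  · by_cases hk : k ∈ H
    · rw [hhigh _ k hk, hhigh _ k hk]
      have h1 := hsR k hk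
      have h2 : 0 ≤ s k * ∑ t ∈ Hᶜ, A k t * (1 - x t) := mul_nonneg (hs0 k)
        (Finset.sum_nonneg fun t _ => mul_nonneg (hA k t) (sub_nonneg.2 (hx1 t)))
      nlinarith
    · rw [hlow _ k hk, hlow _ k hk]
      have h1 := hload k hk
      simp only [mul_sub, Finset.sum_sub_distrib] at h1
      have h2 : ∑ j, f k j * (p * q j) = p * ∑ j, f k j * q j := by
        rw [Finset.mul_sum]; exact Finset.sum_congr rfl fun _ _ => by ring
      nlinarith
  · simp only [revenue, ← Finset.mul_sum]
    rw [Finset.sum_comm]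
    simp [← Finset.mul_sum, hsum, hq1]

/-- The two-price scheme: the products in `C` cost `lo`, all others cost `hi`. A share `s j` of all
buyers with favourite in `L` is mixed with the buyers with favourite `j ∈ H` and is sold `j`; the
remaining buyers learn their favourite, and those with favourite in `C` buy. -/
theorem exists_twoPrice {lo hi : ℝ} (hlo : 0 ≤ lo) (hlohi : lo ≤ hi)
    {H L C : Finset (Fin m)} (hHL : Disjoint H L) (hCL : C ⊆ L)
    {s : Fin m → ℝ} (hs0 : ∀ j, 0 ≤ s j) (hsH : ∀ j, j ∉ H → s j = 0) (hs1 : ∑ j, s j ≤ 1)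
    (hbuy : ∀ j ∈ H, hi * (q j + s j * ∑ i ∈ L, q i) ≤ A j j)
    (hprefer : ∀ j ∈ H, ∀ k ∈ C,
      A k j + s j * ∑ i ∈ L, A k i - lo * (q j + s j * ∑ i ∈ L, q i) ≤
        A j j - hi * (q j + s j * ∑ i ∈ L, q i))
    (hC : ∀ k ∈ C, lo * q k ≤ A k k) (hA : ∀ i j, 0 ≤ A i j) :
    ∃ P : PoolingScheme q A, hi * ∑ j ∈ H, (q j + s j * ∑ i ∈ L, q i) +
      lo * ((∑ k ∈ C, q k) * (1 - ∑ j, s j)) ≤ P.revenue := by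
  have hLH : ∀ {j}, j ∈ H → j ∉ L := fun hj => Finset.disjoint_left.1 hHL hj
  have hCH : ∀ {k}, k ∈ C → k ∉ H := fun hk hkH => hLH hkH (hCL hk)
  let share : Fin m → Fin m → ℝ := fun t k =>
    if t ∈ L then (if k = t then 1 - ∑ j, s j else 0) + s k else if k = t then 1 else 0
  have hsum : ∀ j, ∑ k, share j k = 1 := fun j => by
    by_cases hj : j ∈ L <;> simp [share, hj, Finset.sum_add_distrib]
  have hhigh : ∀ (a : Fin m → ℝ) k, k ∈ H →
      ∑ t, a t * share t k = a k + s k * ∑ t ∈ L, a t := fun a k hk => by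
    rw [← Finset.sum_compl_add_sum L, Finset.mul_sum]
    congr 1
    · rw [Finset.sum_eq_single_of_mem k (Finset.mem_compl.2 (hLH hk))]
      · simp [share, hLH hk]
      · intro t ht htk
        simp [share, Finset.mem_compl.1 ht, htk.symm]
    · refine Finset.sum_congr rfl fun t ht => ?_
      have hkt : k ≠ t := fun h => hLH hk (h ▸ ht)
      simp [share, ht, hkt]; ring
  have hlow : ∀ (a : Fin m → ℝ) k, k ∈ C →
      ∑ t, a t * share t k = a k * (1 - ∑ j, s j) := fun a k hk => by
    rw [Finset.sum_eq_single_of_mem k (Finset.mem_univ k)]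
    · simp [share, hCL hk, hsH k (hCH hk)]
    · intro t _ htk
      by_cases ht : t ∈ L <;> simp [share, ht, htk.symm, hsH k (hCH hk)]
  refine ⟨{ share := share
            label := fun k => if k ∈ H then insert k L else {k}
            price := fun i => if i ∈ C then lo else hi
            rate := fun k => if k ∈ H then hi else if k ∈ C then lo else 0
            share_nonneg := fun j k => ?_
            sum_share := hsum
            label_injective := fun k l hkl => ?_
            mem_label_self := fun k => ?_
            mem_label := fun j k hjk => ?_
            price_nonneg := fun i => ?_
            ncard_price := ncard_range_le_two_of_forall (a := lo) (b := hi)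
              fun i => by split_ifs <;> simp
            sells := fun k => ?_ }, ?_⟩
  · have h1 := hs0 k
    simp only [share]
    split_ifs <;> linarith
  · simp only at hkl
    split_ifs at hkl with hk hl hl
    · have : k ∈ insert l L := hkl ▸ Finset.mem_insert_self k L
      exact (Finset.mem_insert.1 this).resolve_right (hLH hk)
    · have : k ∈ ({l} : Finset (Fin m)) := hkl ▸ Finset.mem_insert_self k L
      exact Finset.mem_singleton.1 this
    · have : l ∈ ({k} : Finset (Fin m)) := hkl ▸ Finset.mem_insert_self l L
      exact (Finset.mem_singleton.1 this).symm
    · exact Finset.singleton_injective hkl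
  · split_ifs <;> simp
  · simp only [share] at hjk
    by_cases hkj : k = j
    · subst hkj; split_ifs <;> simp
    · by_cases hj : j ∈ L
      · have hk : k ∈ H := by
          by_contra hk
          simp [hj, hkj, hsH k hk] at hjk
        simp [hk, hj]
      · simp [hj, hkj] at hjk
  · split_ifs <;> linarith
  · by_cases hk : k ∈ H
    · have hkC : k ∉ C := fun h => hCH h hk
      refine Or.inr ⟨k, by simp [hk, hkC], ?_, fun l hl => ?_⟩
      · rw [hhigh _ k hk, hhigh _ k hk, if_neg hkC]
        have : 0 ≤ s k * ∑ t ∈ L, A k t :=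
          mul_nonneg (hs0 k) (Finset.sum_nonneg fun t _ => hA k t)
        linarith [hbuy k hk]
      · have hlC : l ∈ C := by
          by_contra hlC
          simp [hk, hlC] at hl
        rw [hhigh _ k hk, hhigh _ k hk, hhigh _ k hk, if_neg hkC, if_pos hlC]
        have : 0 ≤ s k * ∑ t ∈ L, A k t :=
          mul_nonneg (hs0 k) (Finset.sum_nonneg fun t _ => hA k t)
        linarith [hprefer k hk l hlC]
    · by_cases hkC : k ∈ C
      · refine Or.inr ⟨k, by simp [hk, hkC], ?_, fun l hl => ?_⟩
        · rw [hlow _ k hkC, hlow _ k hkC, if_pos hkC, ← mul_assoc]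
          exact mul_le_mul_of_nonneg_right (hC k hkC) (by linarith)
        · simp only [hk, hkC, if_true, if_false] at hl
          split_ifs at hl <;> linarith
      · exact Or.inl (by simp [hk, hkC])
  · simp only [revenue]
    have e : ∀ k, (if k ∈ H then hi else if k ∈ C then lo else 0) * ∑ j, q j * share j k =
        (if k ∈ H then hi * (q k + s k * ∑ i ∈ L, q i) else 0) +
        if k ∈ C then lo * (q k * (1 - ∑ j, s j)) else 0 := fun k => by
      by_cases hk : k ∈ H
      · have hkC : k ∉ C := fun h => hCH h hk
        simp [hk, hkC, hhigh q k hk]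
      · by_cases hkC : k ∈ C
        · simp [hk, hkC, hlow q k hkC]
        · simp [hk, hkC]
    simp only [e, Finset.sum_add_distrib, Finset.sum_ite_mem, Finset.univ_inter,
      ← Finset.mul_sum, ← Finset.sum_mul]
    exact le_of_eq rfl

end PoolingScheme

/-! ### A pooling scheme for every market -/

namespace PoolingScheme

variable {m : ℕ} {q : Fin m → ℝ} {A : Fin m → Fin m → ℝ}

/-- The two-price alternative. Here `H` consists of the products whose favourites value them at
`0.5017` or more on average; they contribute less than `0.5017` to the welfare `1`, so almost all
buyers lie outside `H` and have an average value close to `1 / 2`. If, up to a small set `B` of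
products and a small subset `bad` of `H`, the buyers in `H` do not like the products outside `H`
too much, then the price `0.4` for the latter and `1.8` for the former does well. -/
theorem exists_twoPrice_of_exceptional (hq : ∀ j, 0 ≤ q j) (hq1 : ∑ j, q j = 1)
    (hA : ∀ i j, 0 ≤ A i j) (hAd : ∀ i j, A i j ≤ A j j) (hW : ∑ j, A j j = 1)
    {H : Finset (Fin m)} (hH : ∀ j, j ∈ H ↔ 0.5017 * q j ≤ A j j)
    (hHW : ∑ j ∈ H, A j j < 0.5017)
    {B bad : Finset (Fin m)} (hB : ∑ i ∈ B, q i ≤ 0.0115) (hbadH : bad ⊆ H)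
    (hbad : ∑ j ∈ bad, (A j j - 0.5017 * q j) ≤ 0.0024)
    (hgood : ∀ i j, i ∉ H → i ∉ B → 0.4 * q i ≤ A i i → j ∈ H → j ∉ bad →
      A i j - 0.5017 * q j ≤ (A j j - 0.5017 * q j) / 2) :
    ∃ P : PoolingScheme q A, 0.5017 ≤ P.revenue := by
  have hLlt : ∀ i ∈ Hᶜ, A i i ≤ 0.5017 * q i := fun i hi => by
    have := Finset.mem_compl.1 hi
    rw [hH, not_le] at this
    exact this.le
  -- masses and welfare contributions of `H` and of its complement
  have hqs : ∑ j ∈ H, q j + ∑ i ∈ Hᶜ, q i = 1 := by rw [Finset.sum_add_sum_compl, hq1]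
  have hws : ∑ j ∈ H, A j j + ∑ i ∈ Hᶜ, A i i = 1 := by rw [Finset.sum_add_sum_compl, hW]
  have hwL : ∑ i ∈ Hᶜ, A i i ≤ 0.5017 * ∑ i ∈ Hᶜ, q i := by
    rw [Finset.mul_sum]; exact Finset.sum_le_sum hLlt
  have hQH0 : 0 ≤ ∑ j ∈ H, q j := Finset.sum_nonneg fun j _ => hq j
  have hQL : 0.9932 ≤ ∑ i ∈ Hᶜ, q i := by linarith
  set QL := ∑ i ∈ Hᶜ, q i with hQLdef
  have hQLpos : 0 < QL := by linarith
  -- the products sold at the low price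
  let C : Finset (Fin m) := Hᶜ.filter fun i => i ∉ B ∧ 0.4 * q i ≤ A i i
  have hC : ∀ {i}, i ∈ C ↔ i ∉ H ∧ i ∉ B ∧ 0.4 * q i ≤ A i i := fun {i} => by simp [C]
  have hCmass : 0.955 ≤ ∑ i ∈ C, q i := by
    have h1 : ∑ i ∈ Hᶜ, A i i ≤ ∑ i ∈ Hᶜ, 0.4 * q i +
        (∑ i ∈ C, 0.1017 * q i + ∑ i ∈ B, 0.1017 * q i) := by
      have e : ∑ i ∈ C, 0.1017 * q i + ∑ i ∈ B, 0.1017 * q i =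
          ∑ i, ((if i ∈ C then 0.1017 * q i else 0) + if i ∈ B then 0.1017 * q i else 0) := by
        simp [Finset.sum_add_distrib, Finset.sum_ite_mem]
      have h2 : ∀ i, 0 ≤ (if i ∈ C then 0.1017 * q i else 0) +
          if i ∈ B then 0.1017 * q i else 0 := fun i => by
        have := hq i
        split_ifs <;> linarith
      rw [e]
      refine le_trans ?_ (add_le_add_right (Finset.sum_le_sum_of_subset_of_nonneg
        (Finset.subset_univ Hᶜ) fun i _ _ => h2 i) _)
      rw [← Finset.sum_add_distrib]
      refine Finset.sum_le_sum fun i hi => ?_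
      have h3 := h2 i
      have h4 := hLlt i hi
      have h5 := hq i
      by_cases hiA : 0.4 * q i ≤ A i i
      · by_cases hiB : i ∈ B
        · rw [if_pos hiB]; split_ifs <;> linarith
        · rw [if_pos (hC.2 ⟨Finset.mem_compl.1 hi, hiB, hiA⟩), if_neg hiB]; linarith
      · linarith [not_le.1 hiA]
    simp only [← Finset.mul_sum] at h1
    rw [← hQLdef] at h1
    linarith
  have hCQL : ∑ i ∈ C, q i ≤ QL :=
    Finset.sum_le_sum_of_subset_of_nonneg (Finset.filter_subset _ _) fun i _ _ => hq i
  -- the products that attract a pool at the high price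
  let K : Finset (Fin m) := H.filter fun j => j ∉ bad ∧ 4 * q j ≤ A j j
  have hK : ∀ {j}, j ∈ K ↔ j ∈ H ∧ j ∉ bad ∧ 4 * q j ≤ A j j := fun {j} => by simp [K]
  have hKH : K ⊆ H := Finset.filter_subset _ _
  have hKw : 0.465 ≤ ∑ j ∈ K, A j j := by
    have h1 : ∑ j ∈ H, A j j ≤ ∑ j ∈ K, A j j +
        (∑ j ∈ bad, (A j j - 0.5017 * q j) + ∑ j ∈ H, 4.5017 * q j) := by
      rw [← Finset.inter_eq_right.2 hKH, ← Finset.inter_eq_right.2 hbadH, ← Finset.sum_ite_mem,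
        ← Finset.sum_ite_mem, ← Finset.sum_add_distrib, ← Finset.sum_add_distrib]
      refine Finset.sum_le_sum fun j hj => ?_
      have h2 := (hH j).1 hj
      have h3 := hq j
      by_cases hjb : j ∈ bad
      · rw [if_pos hjb]; split_ifs <;> linarith
      · by_cases hjA : 4 * q j ≤ A j j
        · rw [if_pos (hK.2 ⟨hj, hjb, hjA⟩), if_neg hjb]; linarith
        · rw [if_neg hjb, if_neg fun h => hjA (hK.1 h).2.2]; linarith [not_le.1 hjA]
    rw [← Finset.mul_sum] at h1
    linarith
  have hKw' : ∑ j ∈ K, A j j ≤ 0.5017 :=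
    (Finset.sum_le_sum_of_subset_of_nonneg hKH fun j _ _ => hA j j).trans hHW.le
  -- so many others join the buyers with favourite `j` that the pool has mass `A j j / 4`
  let s : Fin m → ℝ := fun j => if j ∈ K then (A j j / 4 - q j) / QL else 0
  have hmass : ∀ j ∈ K, q j + s j * QL = A j j / 4 := fun j hj => by
    simp only [s, if_pos hj]; rw [div_mul_cancel₀ _ hQLpos.ne']; ring
  have hs0 : ∀ j, 0 ≤ s j := fun j => by
    simp only [s]
    split_ifs with hj
    · refine div_nonneg ?_ hQLpos.le
      have := (hK.1 hj).2.2
      rw [sub_nonneg, le_div_iff₀ (by norm_num)]; linarith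
    · exact le_rfl
  have hsK : ∀ j, j ∉ K → s j = 0 := fun j hj => by simp only [s, if_neg hj]
  have hsum : (∑ j, s j) * QL ≤ (∑ j ∈ K, A j j) / 4 := by
    rw [← Finset.sum_subset (Finset.subset_univ K) fun j _ hj => hsK j hj, Finset.sum_mul,
      Finset.sum_div]
    exact Finset.sum_le_sum fun j hj => by linarith [hmass j hj, hq j]
  have hσ0 : 0 ≤ ∑ j, s j := Finset.sum_nonneg fun j _ => hs0 j
  have hσ1 : ∑ j, s j ≤ 1 := by
    by_contra h
    nlinarith [not_le.1 h]
  obtain ⟨P, hP⟩ := exists_twoPrice (q := q) (A := A) (lo := 0.4) (hi := 1.8) (H := K) (L := Hᶜ)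
    (C := C) (s := s) (by norm_num) (by norm_num)
    (Finset.disjoint_left.2 fun j hj hj' => Finset.mem_compl.1 hj' (hKH hj))
    (Finset.filter_subset _ _) hs0 hsK hσ1
    (fun j hj => by
      rw [← hQLdef, hmass j hj]; linarith [hA j j])
    (fun j hj k hk => by
      -- half of the value `A j j` must cover `1.8 - 0.4 + 0.5017 < 2` per member of the pool
      rw [← hQLdef, hmass j hj]
      have h1 : ∑ i ∈ Hᶜ, A k i ≤ 0.5017 * QL :=
        (Finset.sum_le_sum fun i _ => hAd k i).trans hwL
      have h2 := mul_le_mul_of_nonneg_left h1 (hs0 j)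
      have h3 := hmass j hj
      have h4 := hgood k j (hC.1 hk).1 (hC.1 hk).2.1 (hC.1 hk).2.2 (hKH hj) (hK.1 hj).2.1
      linarith [hq j, hA j j])
    (fun k hk => (hC.1 hk).2.2) hA
  refine ⟨P, le_trans ?_ hP⟩
  rw [← hQLdef, Finset.sum_congr rfl hmass, ← Finset.sum_div]
  have h1 : (∑ i ∈ C, q i) * ∑ j, s j ≤ (∑ j, s j) * QL := by
    rw [mul_comm]; exact mul_le_mul_of_nonneg_left hCQL hσ0
  rw [mul_sub, mul_one]
  linarith

/-- Pools indexed by `k` on either side of a partition can be labelled by `k` together with the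
whole opposite side, except that for two singletons the two labels would coincide. -/
theorem label_injective_of_card {H : Finset (Fin m)} (h : ¬ (H.card = 1 ∧ Hᶜ.card = 1)) :
    Function.Injective fun k => if k ∈ H then insert k Hᶜ else insert k H := by
  have key : ∀ k l, k ∈ H → l ∉ H → insert k Hᶜ ≠ insert l H := fun k l hk hl heq => by
    refine h ⟨Finset.card_eq_one.2 ⟨k, Finset.eq_singleton_iff_unique_mem.2 ⟨hk, fun x hx => ?_⟩⟩,
      Finset.card_eq_one.2 ⟨l, Finset.eq_singleton_iff_unique_mem.2
        ⟨Finset.mem_compl.2 hl, fun x hx => ?_⟩⟩⟩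
    · have : x ∈ insert k Hᶜ := heq ▸ Finset.mem_insert_of_mem hx
      exact (Finset.mem_insert.1 this).resolve_right fun h' => Finset.mem_compl.1 h' hx
    · have : x ∈ insert l H := heq ▸ Finset.mem_insert_of_mem hx
      exact (Finset.mem_insert.1 this).resolve_right (Finset.mem_compl.1 hx)
  intro k l hkl
  simp only at hkl
  split_ifs at hkl with hk hl hl
  · have : k ∈ insert l Hᶜ := hkl ▸ Finset.mem_insert_self k _
    exact (Finset.mem_insert.1 this).resolve_right fun h' => Finset.mem_compl.1 h' hk
  · exact absurd hkl (key k l hk hl)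
  · exact absurd hkl.symm (key l k hl hk)
  · have : k ∈ insert l H := hkl ▸ Finset.mem_insert_self k _
    exact (Finset.mem_insert.1 this).resolve_right hk

theorem label_injective_one_sided (H : Finset (Fin m)) :
    Function.Injective fun k => if k ∈ H then insert k Hᶜ else {k} := by
  intro k l hkl
  simp only at hkl
  split_ifs at hkl with hk hl hl
  · have : k ∈ insert l Hᶜ := hkl ▸ Finset.mem_insert_self k _
    exact (Finset.mem_insert.1 this).resolve_right fun h' => Finset.mem_compl.1 h' hk
  · have : k ∈ ({l} : Finset (Fin m)) := hkl ▸ Finset.mem_insert_self k _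
    exact Finset.mem_singleton.1 this
  · have : l ∈ ({k} : Finset (Fin m)) := hkl ▸ Finset.mem_insert_self l _
    exact (Finset.mem_singleton.1 this).symm
  · exact Finset.singleton_injective hkl

/-- If the products with mean value at least `p` contribute at least `p` to the welfare, then a
uniform price `p` sells to everybody. -/
theorem exists_uniform_of_le {p : ℝ} (hp : 0 < p) (hq1 : ∑ j, q j = 1)
    (hA : ∀ i j, 0 ≤ A i j) {H : Finset (Fin m)} (hH : ∀ j ∈ H, p * q j ≤ A j j)
    (hHW : p ≤ ∑ j ∈ H, A j j) :
    ∃ P : PoolingScheme q A, p ≤ P.revenue := by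
  have hne : H.Nonempty := by
    by_contra h
    rw [Finset.not_nonempty_iff_eq_empty.1 h, Finset.sum_empty] at hHW
    linarith
  refine exists_uniform hp.le hq1 hA hne hH (f := fun _ _ => 0) (x := fun _ => 0)
    (fun _ _ => le_rfl) (fun _ _ _ => rfl) (by simp) (fun _ => le_rfl) (fun _ => zero_le_one)
    (by simp) ?_ (label_injective_one_sided H) (fun k => ?_) (fun i j h => absurd rfl h)
    (fun i j hi hj _ => by simp [hi, hj])
  · have hqs : ∑ j ∈ H, q j + ∑ i ∈ Hᶜ, q i = 1 := by rw [Finset.sum_add_sum_compl, hq1]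
    simp only [sub_zero, mul_one, Finset.sum_const_zero, one_mul, Finset.sum_sub_distrib,
      ← Finset.mul_sum]
    have : ∑ i ∈ Hᶜ, q i = 1 - ∑ j ∈ H, q j := by linarith
    rw [this]
    linarith
  · split_ifs <;> simp

/-- The case of two products, one of them in `H` and the other outside. There are too few sets to
label both kinds of pools at the same time, but then either no information at all makes everybody
buy the product outside `H`, or the buyers in `H` hardly value it. -/
theorem exists_of_card_eq_one (hq : ∀ j, 0 ≤ q j) (hq1 : ∑ j, q j = 1)
    (hA : ∀ i j, 0 ≤ A i j) (hAd : ∀ i j, A i j ≤ A j j) (hW : ∑ j, A j j = 1)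
    {H : Finset (Fin m)} (hH : ∀ j, j ∈ H ↔ 0.5017 * q j ≤ A j j)
    (hHW : ∑ j ∈ H, A j j < 0.5017) (h1 : H.card = 1) (h1' : Hᶜ.card = 1) :
    ∃ P : PoolingScheme q A, 0.5017 ≤ P.revenue := by
  obtain ⟨j, hj⟩ := Finset.card_eq_one.1 h1
  obtain ⟨i, hi⟩ := Finset.card_eq_one.1 h1'
  have hjH : ∀ {k}, k ∈ H ↔ k = j := by simp [hj]
  have hiH : ∀ {k}, k ∉ H ↔ k = i := fun {k} => by rw [← Finset.mem_compl, hi]; simp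
  have hsum : ∀ a : Fin m → ℝ, ∑ k, a k = a j + a i := fun a => by
    rw [← Finset.sum_add_sum_compl H, hi, hj, Finset.sum_singleton, Finset.sum_singleton]
  have hi' : i ∉ H := hiH.2 rfl
  have hj' : j ∈ H := hjH.2 rfl
  have hij : i ≠ j := fun h => hi' (h ▸ hj')
  rw [hsum] at hq1 hW
  rw [hj, Finset.sum_singleton] at hHW
  have hdj := (hH j).1 hj'
  have hci : A i i < 0.5017 * q i := by rw [← not_le, ← hH]; exact hi'
  by_cases hpool : 0.5017 ≤ A i i + A i j
  · -- without any information everybody buys `i`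
    refine exists_uniform (by norm_num) (by rw [hsum, hq1]) hA ⟨j, hj'⟩
      (fun k hk => (hH k).1 hk)
      (f := fun k l => if k = i ∧ l = j then 1 else 0) (x := fun _ => 1)
      (label := fun k => if k = j then {j} else insert k {j})
      (fun k l => ?_) (fun k l hkl => ?_) (fun l => ?_)
      (fun _ => zero_le_one) (fun _ => le_rfl) (fun k hk => ?_) ?_ (fun k l hkl => ?_)
      (fun k => ?_) (fun k l hkl => ?_) (fun k l _ _ h => absurd rfl h)
    · split_ifs <;> norm_num
    · exact if_neg fun h => hkl ⟨hiH.2 h.1, hjH.2 h.2⟩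
    · rw [hsum]; simp only [hij.symm, false_and, if_false, true_and, zero_add]
      split_ifs <;> norm_num
    · obtain rfl := hiH.1 hk
      rw [hsum]; simp only [hij, and_self, and_false, if_true, if_false]
      linarith
    · simp only [sub_self, mul_zero, Finset.sum_const_zero]
      rw [hj, Finset.sum_singleton, hsum]
      simp [hij.symm]
    · have hk : k = j ∨ k = i := by
        by_cases h : k ∈ H
        exacts [Or.inl (hjH.1 h), Or.inr (hiH.1 h)]
      have hl : l = j ∨ l = i := by
        by_cases h : l ∈ H
        exacts [Or.inl (hjH.1 h), Or.inr (hiH.1 h)]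
      have hne : insert i {j} ≠ ({j} : Finset (Fin m)) := fun h => by
        have : i ∈ ({j} : Finset (Fin m)) := h ▸ Finset.mem_insert_self i _
        exact hij (Finset.mem_singleton.1 this)
      rcases hk with rfl | rfl <;> rcases hl with rfl | rfl
      · rfl
      · simp only [if_true, if_neg hij] at hkl; exact absurd hkl.symm hne
      · simp only [if_true, if_neg hij] at hkl; exact absurd hkl hne
      · rfl
    · split_ifs with h <;> simp [h]
    · have : k = i ∧ l = j := by
        by_contra h
        exact hkl (if_neg h)
      rw [this.1, this.2, if_neg hij]; simp
  · refine exists_twoPrice_of_exceptional hq (by rw [hsum, hq1]) hA hAd (by rw [hsum, hW]) hH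
      (by rwa [hj, Finset.sum_singleton]) (B := ∅) (bad := ∅) (by norm_num) (by simp)
      (by norm_num) fun k l hk _ _ hl _ => ?_
    obtain rfl := hiH.1 hk
    obtain rfl := hjH.1 hl
    linarith [not_le.1 hpool, hq l]

/-- In every market of welfare `1` some pooling scheme earns `0.5017`. A maximal transport plan
assigns buyers in `H` to products `i ∉ H` that they value highly enough, until the average value of
`i` rises to `0.5017`. If this lifts a mass `0.0115` of buyers, uniform pricing succeeds; otherwise
the saturated and exhausted products are few enough for the two-price scheme. -/
theorem exists_of_welfare_eq_one (hq : ∀ j, 0 ≤ q j) (hq1 : ∑ j, q j = 1)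
    (hA : ∀ i j, 0 ≤ A i j) (hAd : ∀ i j, A i j ≤ A j j) (hW : ∑ j, A j j = 1) :
    ∃ P : PoolingScheme q A, 0.5017 ≤ P.revenue := by
  classical
  let H : Finset (Fin m) := Finset.univ.filter fun j => 0.5017 * q j ≤ A j j
  have hH : ∀ j, j ∈ H ↔ 0.5017 * q j ≤ A j j := fun j => by simp [H]
  by_cases hHW : 0.5017 ≤ ∑ j ∈ H, A j j
  · exact exists_uniform_of_le (by norm_num) hq1 hA (fun j hj => (hH j).1 hj) hHW
  rw [not_le] at hHW
  by_cases hcard : H.card = 1 ∧ Hᶜ.card = 1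
  · exact exists_of_card_eq_one hq hq1 hA hAd hW hH hHW hcard.1 hcard.2
  have hlt : ∀ i, i ∉ H → A i i < 0.5017 * q i := fun i hi => by rwa [hH, not_le] at hi
  let d : Fin m → ℝ := fun j => A j j - 0.5017 * q j
  have hd : ∀ j ∈ H, 0 ≤ d j := fun j hj => sub_nonneg.2 ((hH j).1 hj)
  let b : Fin m → Fin m → ℝ := fun i j => A i j - 0.5017 * q j
  let good : Fin m → Fin m → Prop := fun i j =>
    i ∉ H ∧ 0.4 * q i ≤ A i i ∧ j ∈ H ∧ d j / 2 ≤ b i j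
  obtain ⟨f, hf, hf0, hf1, hload, hsat⟩ := exists_maximal_transport good b
    (fun i j h => (div_nonneg (hd j h.2.2.1) (by norm_num)).trans h.2.2.2)
    (fun i => max (0.5017 * q i - A i i) 0) (fun i => le_max_right _ _)
  have hcap : ∀ i, i ∉ H → max (0.5017 * q i - A i i) 0 = 0.5017 * q i - A i i := fun i hi =>
    max_eq_left (sub_nonneg.2 (hlt i hi).le)
  -- the load of `i`, and the share of its buyers that can be sold `i` with it
  let U : Fin m → ℝ := fun i => ∑ j, f i j * b i j
  have hfb : ∀ i j, f i j * d j ≤ 2 * (f i j * b i j) := fun i j => by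
    by_cases h : good i j
    · nlinarith [hf i j, h.2.2.2]
    · simp [hf0 i j h]
  have hfb0 : ∀ i j, 0 ≤ f i j * b i j := fun i j => by
    by_cases h : good i j
    · exact mul_nonneg (hf i j) ((div_nonneg (hd j h.2.2.1) (by norm_num)).trans h.2.2.2)
    · simp [hf0 i j h]
  have hU0 : ∀ i, 0 ≤ U i := fun i => Finset.sum_nonneg fun j _ => hfb0 i j
  have hUz : ∀ i, ¬ (i ∉ H ∧ 0.4 * q i ≤ A i i) → U i = 0 := fun i hi =>
    Finset.sum_eq_zero fun j _ => by rw [hf0 i j fun h => hi ⟨h.1, h.2.1⟩, zero_mul]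
  let x : Fin m → ℝ := fun i => if i ∈ H then 0 else U i / (0.5017 * q i - A i i)
  have hxU : ∀ i, i ∉ H → x i * (0.5017 * q i - A i i) = U i := fun i hi => by
    simp only [x, if_neg hi]
    exact div_mul_cancel₀ _ (sub_pos.2 (hlt i hi)).ne'
  have hx : ∀ i, 0 ≤ x i := fun i => by
    by_cases hi : i ∈ H
    · simp [x, hi]
    · simp only [x, if_neg hi]
      exact div_nonneg (hU0 i) (sub_nonneg.2 (hlt i hi).le)
  have hx1 : ∀ i, x i ≤ 1 := fun i => by
    by_cases hi : i ∈ H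
    · simp [x, hi]
    · simp only [x, if_neg hi]
      rw [div_le_one (sub_pos.2 (hlt i hi)), ← hcap i hi]
      exact hload i
  set X := ∑ i ∈ Hᶜ, q i * x i with hX
  have hUX : ∑ i, U i ≤ 0.1017 * X := by
    rw [← Finset.sum_subset (Finset.subset_univ Hᶜ) fun i _ hi =>
      hUz i fun h => hi (Finset.mem_compl.2 h.1), hX, Finset.mul_sum]
    refine Finset.sum_le_sum fun i hi => ?_
    have hi' := Finset.mem_compl.1 hi
    by_cases h : 0.4 * q i ≤ A i i
    · rw [← hxU i hi']
      nlinarith [hx i]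
    · rw [hUz i fun h' => h h'.2]
      have := mul_nonneg (hq i) (hx i)
      linarith
  have hfd : ∑ j ∈ H, (∑ i, f i j) * d j ≤ 2 * ∑ i, U i := by
    calc ∑ j ∈ H, (∑ i, f i j) * d j ≤ ∑ j ∈ H, ∑ i, 2 * (f i j * b i j) :=
          Finset.sum_le_sum fun j _ => by
            rw [Finset.sum_mul]; exact Finset.sum_le_sum fun i _ => hfb i j
      _ ≤ ∑ j, ∑ i, 2 * (f i j * b i j) :=
          Finset.sum_le_sum_of_subset_of_nonneg (Finset.subset_univ H) fun j _ _ =>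
            Finset.sum_nonneg fun i _ => mul_nonneg (by norm_num) (hfb0 i j)
      _ = 2 * ∑ i, U i := by
          rw [Finset.sum_comm]; simp only [U, Finset.mul_sum]
  have hqs : ∑ j ∈ H, q j + ∑ i ∈ Hᶜ, q i = 1 := by rw [Finset.sum_add_sum_compl, hq1]
  have hws : ∑ j ∈ H, A j j + ∑ i ∈ Hᶜ, A i i = 1 := by rw [Finset.sum_add_sum_compl, hW]
  have hwL : ∑ i ∈ Hᶜ, A i i ≤ 0.5017 * ∑ i ∈ Hᶜ, q i := by
    rw [Finset.mul_sum]
    exact Finset.sum_le_sum fun i hi => (hlt i (Finset.mem_compl.1 hi)).le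
  have hQH0 : 0 ≤ ∑ j ∈ H, q j := Finset.sum_nonneg fun j _ => hq j
  -- `0.5017 - 2 * 0.1017` times `0.0115` exceeds the deficit `2 * 0.5017 - 1`
  rcases le_total 0.0115 X with hXbig | hXsmall
  · -- mixing buyers from `H` into the others pays off under a uniform price
    have hne : H.Nonempty := by
      by_contra h
      rw [Finset.not_nonempty_iff_eq_empty.1 h] at hqs hws
      simp only [Finset.sum_empty, zero_add] at hqs hws
      rw [Finset.not_nonempty_iff_eq_empty.1 h] at hwL
      linarith
    refine exists_uniform (by norm_num) hq1 hA hne (fun j hj => (hH j).1 hj) hf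
      (fun i j h => hf0 i j fun hg => h ⟨hg.1, hg.2.2.1⟩) hf1 hx hx1
      (fun i hi => (hxU i hi).le) ?_ (label_injective_of_card hcard) (fun k => ?_)
      (fun i j hij => ?_) (fun i j hi hj _ => by simp [hi, hj])
    · have e1 : ∑ i ∈ Hᶜ, q i * (1 - x i) = ∑ i ∈ Hᶜ, q i - X := by
        rw [hX, ← Finset.sum_sub_distrib]; exact Finset.sum_congr rfl fun _ _ => by ring
      have e2 : ∑ j ∈ H, (1 - ∑ i, f i j) * (A j j - 0.5017 * q j) =
          ∑ j ∈ H, A j j - 0.5017 * ∑ j ∈ H, q j - ∑ j ∈ H, (∑ i, f i j) * d j := by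
        rw [Finset.mul_sum, ← Finset.sum_sub_distrib, ← Finset.sum_sub_distrib]
        exact Finset.sum_congr rfl fun _ _ => by simp only [d]; ring
      rw [e1, e2]
      linarith
    · split_ifs <;> simp
    · have hg : good i j := by
        by_contra h
        exact hij (hf0 i j h)
      simp [hg.1, hg.2.2.1]
  · -- saturated products outside `H` and exhausted products in `H` are exceptional
    let B : Finset (Fin m) := Hᶜ.filter fun i => x i = 1
    let bad : Finset (Fin m) := H.filter fun j => ∑ i, f i j = 1
    refine exists_twoPrice_of_exceptional hq hq1 hA hAd hW hH hHW (B := B) (bad := bad)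
      ?_ (Finset.filter_subset _ _) ?_ fun i j hi hiB hiA hj hjb => ?_
    · refine le_trans ?_ hXsmall
      calc ∑ i ∈ B, q i = ∑ i ∈ B, q i * x i := Finset.sum_congr rfl fun i hi => by
            rw [(Finset.mem_filter.1 hi).2, mul_one]
        _ ≤ X := Finset.sum_le_sum_of_subset_of_nonneg (Finset.filter_subset _ _)
            fun i _ _ => mul_nonneg (hq i) (hx i)
    · have : ∑ j ∈ bad, (A j j - 0.5017 * q j) ≤ ∑ j ∈ H, (∑ i, f i j) * d j := by
        calc ∑ j ∈ bad, (A j j - 0.5017 * q j) = ∑ j ∈ bad, (∑ i, f i j) * d j :=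
              Finset.sum_congr rfl fun j hj => by rw [(Finset.mem_filter.1 hj).2, one_mul]
          _ ≤ _ := Finset.sum_le_sum_of_subset_of_nonneg (Finset.filter_subset _ _)
              fun j hj _ => mul_nonneg (Finset.sum_nonneg fun i _ => hf i j) (hd j hj)
      linarith
    · by_contra hcon
      have hg : good i j := ⟨hi, hiA, hj, (not_le.1 hcon).le⟩
      rcases hsat i j hg with h | h
      · refine hiB (Finset.mem_filter.2 ⟨Finset.mem_compl.2 hi, ?_⟩)
        simp only [x, if_neg hi, U]
        rw [h, hcap i hi]
        exact div_self (sub_pos.2 (hlt i hi)).ne'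
      · exact hjb (Finset.mem_filter.2 ⟨hj, h⟩)

/-- The scheme that tells everybody the favourite product and gives all products away. -/
def giveaway (q : Fin m → ℝ) (A : Fin m → Fin m → ℝ) : PoolingScheme q A where
  share j k := if k = j then 1 else 0
  label k := {k}
  price _ := 0
  rate _ := 0
  share_nonneg j k := by split_ifs <;> norm_num
  sum_share j := by simp
  label_injective := Finset.singleton_injective
  mem_label_self k := by simp
  mem_label j k h := by
    have : k = j := by by_contra hne; exact h (if_neg hne)
    simp [this]
  price_nonneg _ := le_rfl
  ncard_price := ncard_range_le_two_of_forall (b := 0) fun _ => Or.inl rfl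
  sells _ := Or.inl rfl

/-- In every market some pooling scheme earns the fraction `0.5017` of the welfare. -/
theorem exists_revenue_ge (hq : ∀ j, 0 ≤ q j) (hq1 : ∑ j, q j = 1)
    (hA : ∀ i j, 0 ≤ A i j) (hAd : ∀ i j, A i j ≤ A j j) :
    ∃ P : PoolingScheme q A, 0.5017 * ∑ j, A j j ≤ P.revenue := by
  rcases (Finset.sum_nonneg fun j _ => hA j j : 0 ≤ ∑ j, A j j).eq_or_lt with h0 | hpos
  · exact ⟨giveaway q A, by simp [← h0, giveaway, revenue]⟩
  · set W := ∑ j, A j j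
    obtain ⟨P, hP⟩ := exists_of_welfare_eq_one (A := fun i j => A i j / W) hq hq1
      (fun i j => div_nonneg (hA i j) hpos.le)
      (fun i j => div_le_div_of_nonneg_right (hAd i j) hpos.le)
      (by rw [← Finset.sum_div]; exact div_self hpos.ne')
    have hs : ∀ i j, A i j = W * (A i j / W) := fun i j => (mul_div_cancel₀ _ hpos.ne').symm
    refine ⟨P.scale hpos hs, ?_⟩
    rw [revenue_scale, mul_comm]
    exact mul_le_mul_of_nonneg_left hP hpos.le

end PoolingScheme

/-! ### The pricing mechanism -/

/-- The mechanism guarantees a fraction of the mean value of the favourite product, which bounds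
both the optimal revenue and the optimal welfare. -/
theorem exists_mechanism_ge {m : ℕ} (F : Measure (Fin m → ℝ)) [IsProbabilityMeasure F]
    (hnn : ∀ᵐ v ∂F, ∀ i, 0 ≤ v i)
    (hint : ∀ i, Integrable (fun v : Fin m → ℝ => v i) F)
    {iStar : (Fin m → ℝ) → Fin m} (hmeas : Measurable iStar)
    (hmax : ∀ᵐ v ∂F, ∀ i, v i ≤ v (iStar v)) :
    ∃ (M : Mechanism m (CoarseSignal m)) (price : Fin m → ℝ),
      IsCoarseHorizontal iStar M.signal ∧ M.IsPricingWith F price ∧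
      (Set.range price).ncard ≤ 2 ∧ M.IsIC F ∧ M.IsIR F ∧
      0.5017 * ∫ v, v (iStar v) ∂F ≤ M.rev F := by
  have hm : ∀ j, MeasurableSet (iStar ⁻¹' {j}) := fun j => hmeas (measurableSet_singleton j)
  obtain ⟨P, hP⟩ := PoolingScheme.exists_revenue_ge
    (q := fun j => F.real (iStar ⁻¹' {j})) (A := fun i j => ∫ v in iStar ⁻¹' {j}, v i ∂F)
    (fun j => measureReal_nonneg)
    (by
      have := integral_mul_comp_favourite hmeas (integrable_const (1 : ℝ) (μ := F)) fun _ => 1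
      simpa using this.symm)
    (fun i j => integral_nonneg_of_ae (ae_restrict_of_ae (by
      filter_upwards [hnn] with v hv using hv i)))
    (fun i j => by
      refine setIntegral_mono_on_ae (hint i).integrableOn (hint j).integrableOn (hm j) ?_
      filter_upwards [hmax] with v hv hvj
      have h := hv i
      rwa [show iStar v = j from hvj] at h)
  obtain ⟨M, price, h1, h2, h3, h4, h5, h6⟩ := P.exists_mechanism F hint hmeas
  refine ⟨M, price, h1, h2, h3, h4, h5, le_trans (le_of_eq ?_) (hP.trans h6)⟩
  congr 1
  have h := integral_mul_comp_favourite hmeas (Mechanism.integrable_favourite F hint hmeas)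
    fun _ => 1
  simp only [mul_one] at h
  rw [h]
  refine Finset.sum_congr rfl fun j _ => setIntegral_congr_fun (hm j) fun v hv => ?_
  rw [show iStar v = j from hv]

/-! ### The limits of uniform pricing -/

namespace Mechanism

variable {m : ℕ} {S : Type u} [MeasurableSpace S] (M : Mechanism m S) (F : Measure (Fin m → ℝ))
  [IsProbabilityMeasure F]

theorem ae_posterior {p : (Fin m → ℝ) → Prop} (hp : ∀ᵐ v ∂F, p v) :
    ∀ᵐ s ∂(M.signalLaw F), ∀ᵐ v ∂(posterior M.signal F s), p v := by
  refine Measure.ae_ae_of_ae_comp ?_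
  rwa [signalLaw, posterior_comp_self]

theorem posteriorMean_nonneg {i : Fin m} (h : ∀ᵐ v ∂F, 0 ≤ v i) :
    ∀ᵐ s ∂(M.signalLaw F), 0 ≤ M.posteriorMean F s i := by
  filter_upwards [M.ae_posterior F h] with s hs using integral_nonneg_of_ae hs

theorem posteriorMean_le {i : Fin m} {C : ℝ} (h0 : ∀ᵐ v ∂F, 0 ≤ v i) (h : ∀ᵐ v ∂F, v i ≤ C) :
    ∀ᵐ s ∂(M.signalLaw F), M.posteriorMean F s i ≤ C := by
  filter_upwards [M.ae_posterior F h0, M.ae_posterior F h] with s hs0 hs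
  have := integral_mono_of_nonneg hs0 (integrable_const C) hs
  simpa [posteriorMean] using this

theorem integral_posteriorMean {i : Fin m} (hi : Integrable (fun v : Fin m → ℝ => v i) F) :
    ∫ s, M.posteriorMean F s i ∂(M.signalLaw F) = ∫ v, v i ∂F := by
  have h := M.integral_posteriorMean_mul F hi (measurable_const (a := (1 : ℝ))) (C := 1) (by simp)
  rw [Measure.integral_compProd
    (M.integrable_value_mul F hi (measurable_const (a := (1 : ℝ))) (C := 1) (by simp))] at h
  simpa using h

theorem integrable_posteriorMean {i : Fin m} (hi : Integrable (fun v : Fin m → ℝ => v i) F) :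
    Integrable (fun s => M.posteriorMean F s i) (M.signalLaw F) := by
  simpa using M.integrable_posteriorMean_mul F hi (measurable_const (a := (1 : ℝ))) (C := 1)
    (by simp)

end Mechanism

/-- Let the second of two products be worth at most `1`, and let the first have mean value at most
`1`. A uniform price above `1` sells only the first product, and earns at most its mean value. -/
theorem rev_le_one_of_isUniformPricing {S : Type u} [MeasurableSpace S] (M : Mechanism 2 S)
    (F : Measure (Fin 2 → ℝ)) [IsProbabilityMeasure F]
    (h0 : ∀ᵐ v ∂F, 0 ≤ v 0) (h1 : ∀ᵐ v ∂F, 0 ≤ v 1) (h1' : ∀ᵐ v ∂F, v 1 ≤ 1)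
    (hint : Integrable (fun v : Fin 2 → ℝ => v 0) F) (hmean : ∫ v, v 0 ∂F ≤ 1)
    (hM : M.IsUniformPricing F) : M.rev F ≤ 1 := by
  obtain ⟨p, hp, hx, hbest⟩ := hM
  have hp0 : 0 ≤ p := hp 0
  have hpay : ∀ s, M.pay s = p * ∑ i, M.alloc s i := fun s => by
    rw [(hx s).2, Finset.mul_sum]
  have hpay0 : ∀ s, 0 ≤ M.pay s := fun s => by
    rw [hpay]; exact mul_nonneg hp0 (Finset.sum_nonneg fun i _ => M.alloc_nonneg s i)
  rcases le_or_gt p 1 with hp1 | hp1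
  · have : M.rev F ≤ ∫ _, 1 ∂(M.signalLaw F) := by
      refine integral_mono_of_nonneg (Filter.Eventually.of_forall hpay0) (integrable_const _)
        (Filter.Eventually.of_forall fun s => ?_)
      rw [hpay]
      exact mul_le_one₀ hp1 (Finset.sum_nonneg fun i _ => M.alloc_nonneg s i)
        (M.alloc_sum_le_one s)
    simpa using this
  · refine le_trans ?_ hmean
    rw [← M.integral_posteriorMean F hint]
    refine integral_mono_of_nonneg (Filter.Eventually.of_forall hpay0)
      (M.integrable_posteriorMean F hint) ?_
    filter_upwards [hbest, M.posteriorMean_nonneg F h0, M.posteriorMean_le F h1 h1'] with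
      s hs hν0 hν1
    have h := hs (fun _ => 0) fun _ => Or.inl rfl
    simp only [unitDemandUtility, mul_zero, Finset.sum_const_zero, sub_zero, ciSup_const] at h
    rw [sub_nonneg, ← Finset.mul_sum, ← hpay] at h
    have hle := M.alloc_sum_le_one s
    rw [Fin.sum_univ_two] at hle
    have hpay' := hpay s
    rw [Fin.sum_univ_two] at hpay'
    rcases (hx s).1 1 with hx1 | hx1
    · rcases (hx s).1 0 with hx0 | hx0
      · rw [hpay', hx0, hx1]; simpa using hν0
      · refine h.trans (ciSup_le fun i => ?_)
        fin_cases i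
        · simp [hx0]
        · simpa [hx1] using hν0
    · have hx0 : M.alloc s 0 = 0 := le_antisymm (by linarith) (M.alloc_nonneg s 0)
      -- paying `p > 1` for the second product is not optimal, since it is worth at most `1`
      have h3 : M.pay s ≤ 1 := h.trans (ciSup_le fun i => by
        fin_cases i
        · simp [hx0]
        · simpa [hx1] using hν1)
      rw [hpay', hx0, hx1] at h3
      linarith

/-- A market with two products: with probability `1 / N` only the first one has value, namely `N`,
and otherwise only the second one has value, namely `1`. -/
noncomputable def spikeMarket (N : ℝ) : Measure (Fin 2 → ℝ) :=
  ENNReal.ofReal (1 / N) • Measure.dirac ![N, 0] +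
    ENNReal.ofReal (1 - 1 / N) • Measure.dirac ![0, 1]

theorem ae_spikeMarket {N : ℝ} {p : (Fin 2 → ℝ) → Prop} (h1 : p ![N, 0]) (h2 : p ![0, 1]) :
    ∀ᵐ v ∂(spikeMarket N), p v := by
  refine ae_add_measure_iff.2 ⟨Measure.ae_smul_measure ?_ _, Measure.ae_smul_measure ?_ _⟩
  · rwa [ae_dirac_eq]
  · rwa [ae_dirac_eq]

theorem integrable_spikeMarket {N : ℝ} (f : (Fin 2 → ℝ) → ℝ) : Integrable f (spikeMarket N) :=
  .add_measure (.smul_measure (integrable_dirac (by simp)) ENNReal.ofReal_ne_top)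
    (.smul_measure (integrable_dirac (by simp)) ENNReal.ofReal_ne_top)

section spikeMarket

variable {N : ℝ} (hN : 1 < N)

include hN

theorem isProbabilityMeasure_spikeMarket : IsProbabilityMeasure (spikeMarket N) := ⟨by
  have h1 : 0 ≤ 1 / N := by positivity
  have h2 : 0 ≤ 1 - 1 / N := by rw [sub_nonneg, div_le_one (by linarith)]; exact hN.le
  simp only [spikeMarket, Measure.add_apply, Measure.smul_apply, measure_univ, smul_eq_mul, mul_one]
  rw [← ENNReal.ofReal_add h1 h2]
  simp⟩

theorem integral_spikeMarket (f : (Fin 2 → ℝ) → ℝ) :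
    ∫ v, f v ∂(spikeMarket N) = 1 / N * f ![N, 0] + (1 - 1 / N) * f ![0, 1] := by
  have h1 : 0 ≤ 1 / N := by positivity
  have h2 : 0 ≤ 1 - 1 / N := by rw [sub_nonneg, div_le_one (by linarith)]; exact hN.le
  rw [spikeMarket, integral_add_measure
    (.smul_measure (integrable_dirac (by simp)) ENNReal.ofReal_ne_top)
    (.smul_measure (integrable_dirac (by simp)) ENNReal.ofReal_ne_top),
    integral_smul_measure, integral_smul_measure, integral_dirac, integral_dirac,
    ENNReal.toReal_ofReal h1, ENNReal.toReal_ofReal h2, smul_eq_mul, smul_eq_mul]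

/-- Full disclosure with the prices `N` and `1` extracts the whole welfare of the spike market. -/
theorem le_optRev_spikeMarket [IsProbabilityMeasure (spikeMarket N)] :
    ((2 - 1 / N : ℝ) : EReal) ≤ optRev.{u} (spikeMarket N) := by
  have hN0 : 0 < 1 / N := by positivity
  have hN1 : 0 < 1 - 1 / N := by rw [sub_pos, div_lt_one (by linarith)]; exact hN
  let _ : MeasurableSpace (ULift.{u} (Fin 2)) := ⊤
  have : MeasurableSingletonClass (ULift.{u} (Fin 2)) := ⟨fun _ => trivial⟩
  let g : (Fin 2 → ℝ) → ULift.{u} (Fin 2) := fun v => ⟨if v 0 = 0 then 1 else 0⟩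
  have hg : Measurable g := by
    have h : g = (fun v => if v 0 = 0 then ⟨1⟩ else ⟨0⟩) := by
      funext v; simp only [g]; split_ifs <;> rfl
    rw [h]
    exact Measurable.ite (measurable_pi_apply 0 (measurableSet_singleton 0)) measurable_const
      measurable_const
  have hga : g ![N, 0] = ⟨0⟩ := by
    have : N ≠ 0 := by linarith
    simp [g, this]
  have hgb : g ![0, 1] = ⟨1⟩ := by simp [g]
  let M : Mechanism 2 (ULift.{u} (Fin 2)) :=
    { signal := Kernel.deterministic g hg
      isMarkovKernel_signal := inferInstance
      alloc := fun s i => if i = s.down then 1 else 0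
      pay := fun s => if s.down = 0 then N else 1
      measurable_alloc := fun _ _ => trivial
      measurable_pay := fun _ _ => trivial
      alloc_nonneg := fun s i => by split_ifs <;> norm_num
      alloc_sum_le_one := fun s => by simp }
  have hlaw : M.signalLaw (spikeMarket N) = (spikeMarket N).map g :=
    Measure.deterministic_comp_eq_map hg
  have hint : ∀ φ : ULift.{u} (Fin 2) → ℝ, ∫ s, φ s ∂(M.signalLaw (spikeMarket N)) =
      1 / N * φ ⟨0⟩ + (1 - 1 / N) * φ ⟨1⟩ := fun φ => by
    rw [hlaw, integral_map hg.aemeasurable (measurable_from_top (f := φ)).aestronglyMeasurable,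
      integral_spikeMarket hN, hga, hgb]
  have hreal : ∀ s, (M.signalLaw (spikeMarket N)).real {s} =
      1 / N * Set.indicator {s} (fun _ => (1 : ℝ)) ⟨0⟩ +
        (1 - 1 / N) * Set.indicator {s} (fun _ => (1 : ℝ)) ⟨1⟩ := fun s => by
    rw [← hint, integral_indicator (measurableSet_singleton s)]
    simp [measureReal_def]
  have hν : ∀ s i, M.posteriorMean (spikeMarket N) s i =
      if i = s.down then (if s.down = 0 then N else 1) else 0 := fun s i => by
    have h := M.posteriorMean_mul_signalLaw (spikeMarket N)
      (integrable_spikeMarket fun v => v i) s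
    have hκ : ∀ v, (M.signal v).real {s} = Set.indicator {s} (fun _ => (1 : ℝ)) (g v) := fun v => by
      change ((Kernel.deterministic g hg) v).real {s} = _
      rw [Kernel.deterministic_apply, measureReal_def,
        Measure.dirac_apply' _ (measurableSet_singleton s)]
      by_cases hs : g v = s <;> simp [hs]
    simp only [hκ] at h
    rw [hreal, integral_spikeMarket hN, hga, hgb] at h
    obtain ⟨s⟩ := s
    obtain rfl | rfl : s = 0 ∨ s = 1 := by omega
    · refine mul_right_cancel₀ hN0.ne' ?_
      simp only [Set.indicator, Set.mem_singleton_iff, ULift.up_inj, one_ne_zero, if_true,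
        if_false, mul_one, mul_zero, add_zero] at h
      rw [h]
      fin_cases i <;> simp [mul_comm]
    · refine mul_right_cancel₀ hN1.ne' ?_
      simp only [Set.indicator, Set.mem_singleton_iff, ULift.up_inj, zero_ne_one, if_true,
        if_false, mul_one, mul_zero, zero_add] at h
      rw [h]
      fin_cases i <;> simp
  -- the utility of the report `s'` after the signal `s`
  have hutil : ∀ s s' : ULift.{u} (Fin 2),
      lotteryUtility (M.posteriorMean (spikeMarket N) s) (M.alloc s') (M.pay s') =
        (if s' = s then (if s.down = 0 then N else 1) else 0) -
          if s'.down = 0 then N else 1 := fun s s' => by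
    simp only [lotteryUtility, hν, M, mul_ite, mul_one, mul_zero, Finset.sum_ite_eq',
      Finset.mem_univ, if_true, ULift.ext_iff]
  have hIC : M.IsIC (spikeMarket N) := Filter.Eventually.of_forall fun s s' => by
    rw [hutil, hutil]
    split_ifs <;> simp_all <;> linarith
  have hIR : M.IsIR (spikeMarket N) := Filter.Eventually.of_forall fun s => by
    rw [hutil]; simp
  have hrev : M.rev (spikeMarket N) = 2 - 1 / N := by
    rw [Mechanism.rev, hint]
    simp only [M, if_true, one_ne_zero, if_false]
    field_simp
    ring
  rw [← hrev]
  exact le_iSup_of_le (ULift.{u} (Fin 2)) (le_iSup_of_le _ (le_iSup_of_le M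
    (le_iSup_of_le hIC (le_iSup_of_le hIR le_rfl))))

end spikeMarket

/-! ### The approximation theorem -/

theorem mainTheorem2 :
    (∀ (m : ℕ) (F : Measure (Fin m → ℝ)) [IsProbabilityMeasure F],
      (∀ᵐ v ∂F, ∀ i, 0 ≤ v i) →
      (∀ i, Integrable (fun v : Fin m → ℝ => v i) F) →
      ∀ iStar : (Fin m → ℝ) → Fin m, Measurable iStar →
        (∀ᵐ v ∂F, ∀ i, v i ≤ v (iStar v)) →
        ∃ (M : Mechanism m (CoarseSignal m)) (price : Fin m → ℝ),
          IsCoarseHorizontal iStar M.signal ∧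
          M.IsPricingWith F price ∧
          (Set.range price).ncard ≤ 2 ∧
          M.IsIC F ∧ M.IsIR F ∧
          ((0.5017 : ℝ) : EReal) * optRev.{u} F ≤ (M.rev F : EReal) ∧
          ((0.5017 : ℝ) : EReal) * optWel.{u} F ≤ (M.rev F : EReal)) ∧
    (∀ c : ℝ, 1 / 2 < c →
      ∃ (F : Measure (Fin 2 → ℝ)) (_ : IsProbabilityMeasure F),
        (∃ V : Finset (Fin 2 → ℝ), (∀ v ∈ V, ∀ i, 0 ≤ v i) ∧ F (↑V : Set (Fin 2 → ℝ))ᶜ = 0) ∧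
        ∀ (S : Type u) [MeasurableSpace S] (M : Mechanism 2 S), M.IsUniformPricing F →
          (M.rev F : EReal) < (c : EReal) * optRev.{u} F) := by
  refine ⟨fun m F _ hnn hint iStar hmeas hmax => ?_, fun c hc => ?_⟩
  · obtain ⟨M, price, h1, h2, h3, h4, h5, h6⟩ := exists_mechanism_ge F hnn hint hmeas hmax
    exact ⟨M, price, h1, h2, h3, h4, h5,
      mul_optRev_le F hnn hint hmeas hmax (by norm_num) h6,
      mul_optWel_le F hnn hint hmeas hmax (by norm_num) h6⟩
  · -- `N` is large enough for `c * (2 - 1 / N)` to exceed `1`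
    have hc2 : 0 < 2 * c - 1 := by linarith
    have hc3 : 0 < 3 * c - 1 := by linarith
    obtain ⟨N, hN, hcN⟩ : ∃ N : ℝ, 1 < N ∧ 1 < c * (2 - 1 / N) := by
      refine ⟨(3 * c - 1) / (2 * c - 1), (one_lt_div hc2).2 (by linarith), ?_⟩
      rw [one_div_div]
      have h1 := div_pos hc2 hc3
      have h2 := div_mul_cancel₀ (2 * c - 1) hc3.ne'
      nlinarith
    have hprob := isProbabilityMeasure_spikeMarket hN
    have hV : (↑({![N, 0], ![0, 1]} : Finset (Fin 2 → ℝ)) : Set (Fin 2 → ℝ)) ∈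
        ae (spikeMarket N) := ae_spikeMarket (by simp) (by simp)
    refine ⟨spikeMarket N, hprob, ⟨{![N, 0], ![0, 1]}, fun v hv i => ?_, ?_⟩, fun S _ M hM => ?_⟩
    · simp only [Finset.mem_insert, Finset.mem_singleton] at hv
      rcases hv with rfl | rfl <;> fin_cases i <;> simp
      linarith
    · exact mem_ae_iff.1 hV
    · have hrev := rev_le_one_of_isUniformPricing M (spikeMarket N)
        (ae_spikeMarket (by simp; linarith) (by simp)) (ae_spikeMarket (by simp) (by simp))
        (ae_spikeMarket (by simp) (by simp)) (integrable_spikeMarket _)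
        (by
          rw [integral_spikeMarket hN]
          have : N ≠ 0 := by linarith
          simp [this]) hM
      calc (M.rev (spikeMarket N) : EReal) < ((c * (2 - 1 / N) : ℝ) : EReal) :=
            EReal.coe_lt_coe_iff.2 (hrev.trans_lt hcN)
        _ = (c : EReal) * ((2 - 1 / N : ℝ) : EReal) := EReal.coe_mul _ _
        _ ≤ _ := mul_le_mul_of_nonneg_left (le_optRev_spikeMarket hN)
            (by exact_mod_cast (by linarith : (0 : ℝ) ≤ c))
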